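/- For finite subsets $X,Y$ of an abelian group $\mathbf G$ (written additively) let $$\mathsf E(X,Y)=|\{(a_1,a_2,b_1,b_2)\in X\times X\times Y\times Y:\ a_1-b_1=a_2-b_2\}|,\qquad \mathsf E(X)=\mathsf E(X,X),\qquad \mathcal D[X]=\frac{|X+X|}{|X|},$$ and let $$\mathcal E_*[A]=\max_{X\sqcup Y=A}\frac{|X|^2|Y|^2}{|A|\,\mathsf E(X,Y)},$$ the maximum being over all partitions of $A$ into two disjoint sets $X,Y$ (the quotient is read as $0$ if $X$ or $Y$ is empty). Theorem. There is an absolute constant $C>0$ with the following property. Let $A$ be a finite subset of an abelian group $\mathbf G$, let $K>0$ be a real number with $\mathsf E(A)=|A|^3/K$, and let $\varepsilon,\omega\in(0,1/4]$. Then there are an integer $k\ge 0$ and a decomposition of $A$ as a disjoint union $A=\bigl(\bigsqcup_{j=1}^k A_j\bigr)\sqcup\Omega$ such that (i) $|A_j|\ge \sqrt{\omega/(2K)}\cdot|A|$ for all $j\in\{1,\dots,k\}$; (ii) $\mathcal E_*[A_j]\le 4K(\omega\varepsilon)^{-2}$ for all $j\in\{1,\dots,k\}$, and moreover $\mathcal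 D[A_j]\le \exp\bigl(C\,K^{1/3}(\omega\varepsilon)^{-2/3}\log^2(K\omega^{-1}\varepsilon^{-1})\bigr)$ for all $j\in\{1,\dots,k\}$; (iii) $\mathsf E(A_i,A_j)\le \varepsilon\,\dfrac{|A_i|^2|A_j|^2}{|A|}$ for all $i,j\in\{1,\dots,k\}$ with $i\ne j$; (iv) $\mathsf E(\Omega,A)\le \omega\,\mathsf E(A)$. -/

import Mathlib

open Finset
open scoped Pointwise

/-- The additive energy of Mathlib, `Finset.addEnergy X Y`, counts the solutions of
`a₁ + b₁ = a₂ + b₂`; it is the common additive energy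
`E(X,Y) = |{(a₁, a₂, b₁, b₂) ∈ X × X × Y × Y : a₁ - b₁ = a₂ - b₂}|`. -/
theorem addEnergy_eq_card_sub {G : Type*} [AddCommGroup G] [DecidableEq G] (X Y : Finset G) :
    Finset.addEnergy X Y =
      #{x ∈ (X ×ˢ X) ×ˢ Y ×ˢ Y | x.1.1 - x.2.1 = x.1.2 - x.2.2} := by
  unfold Finset.addEnergy
  refine Finset.card_bij' (fun x _ => (x.1, x.2.swap)) (fun x _ => (x.1, x.2.swap)) ?_ ?_ ?_ ?_
  · rintro ⟨⟨a, b⟩, c, d⟩ h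
    simp only [mem_filter, mem_product, Prod.swap] at h ⊢
    refine ⟨⟨h.1.1, h.1.2.2, h.1.2.1⟩, ?_⟩
    rw [sub_eq_sub_iff_add_eq_add]
    exact h.2
  · rintro ⟨⟨a, b⟩, c, d⟩ h
    simp only [mem_filter, mem_product, Prod.swap] at h ⊢
    refine ⟨⟨h.1.1, h.1.2.2, h.1.2.1⟩, ?_⟩
    have := h.2
    rw [sub_eq_sub_iff_add_eq_add] at this
    exact this
  · intro x _; simp
  · intro x _; simp

/-- The doubling constant `D[A] = |A + A| / |A|`. -/
noncomputable def doubling {G : Type*} [AddCommGroup G] [DecidableEq G] (A : Finset G) : ℝ :=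
  (#(A + A) : ℝ) / (#A : ℝ)

/-- The quantity `E_*[A]`: the maximum of `|X|² |Y|² / (|A| E(X,Y))` over all partitions
`A = X ⊔ Y`, where `X` runs over the subsets of `A` and `Y = A \ X`.
If `X` or `Y` is empty, the quotient is read as `0`; otherwise its denominator is positive. -/
noncomputable def energyStar {G : Type*} [AddCommGroup G] [DecidableEq G] (A : Finset G) : ℝ :=
  A.powerset.sup' (powerset_nonempty A) fun X =>
    ((#X : ℝ) ^ 2 * (#(A \ X) : ℝ) ^ 2) / ((#A : ℝ) * (Finset.addEnergy X (A \ X) : ℝ))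

/-! Among all partitions of `A` into nonempty parts, take one maximizing the sum of `E(X) - μ
p(|X|)`, where `p` is a penalty that is superadditive in a quantitative way. Local optimality yields
everything except the doubling bound. If a part `X ⊔ Y` has too small a cross energy, splitting it
loses at most `4√(E(X,Y) E(X ∪ Y))` of energy but gains more in penalty, so the optimum forces `E_*`
to be bounded. Merging two parts gains at least `4 E(X,Y)` of energy, so `E(X,Y)` is at most the
penalty increment. Comparison with the trivial partition shows that the parts retain almost all of
`E(A)`. Parts that are too small form `Ω`; they carry little energy, and superadditivity of `E(·,
A)` over disjoint sets bounds `E(Ω, A)`. See `addEnergy_union_self`, `partPenalty_split`,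
`partPenalty_merge`, `exists_optimal_partition`.

For the doubling, let `E_*[A] ≤ M`. A balanced partition shows that `A` has large energy, so
Balog–Szemerédi–Gowers gives a dense `X ⊆ A` with small difference set. Every cut of `A` has large
cross energy, so `X` can be grown inside sums `X + U`: two rounds of greedy covering multiply `|X| /
|A \ X|` by `1 + c M^(-1/3)` (`ratio_growth`). After about `M^(1/3) log M` rounds almost all of `A`
is reached, a Ruzsa-type covering captures the rest, and Plünnecke–Ruzsa bounds `A + A`. Each round
multiplies `|U|` by a power of `M`, whence the second logarithm. -/

/-! ### Additive energy through difference representation counts -/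

section EnergyBasics

variable {G : Type*} [AddCommGroup G] [DecidableEq G]

/-- The number of representations of `d` as a difference `x - y` with `x ∈ X` and `y ∈ Y`. -/
def diffCount (X Y : Finset G) (d : G) : ℝ :=
  ∑ x ∈ X, ∑ y ∈ Y, if x - y = d then 1 else 0

theorem diffCount_nonneg (X Y : Finset G) (d : G) : 0 ≤ diffCount X Y d :=
  sum_nonneg fun _ _ => sum_nonneg fun _ _ => by split_ifs <;> norm_num

theorem diffCount_eq_card_right (X Y : Finset G) (d : G) :
    diffCount X Y d = #{y ∈ Y | y + d ∈ X} := by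
  unfold diffCount
  rw [sum_comm, card_filter]
  push_cast
  refine sum_congr rfl fun y _ => ?_
  have : ∀ x : G, (x - y = d) ↔ (y + d = x) := fun x => by
    rw [sub_eq_iff_eq_add, add_comm, eq_comm]
  simp [this]

theorem diffCount_eq_card_left (X Y : Finset G) (d : G) :
    diffCount X Y d = #{x ∈ X | x - d ∈ Y} := by
  unfold diffCount
  rw [card_filter]
  push_cast
  refine sum_congr rfl fun x _ => ?_
  have : ∀ y : G, (x - y = d) ↔ (x - d = y) := fun y => by
    constructor <;> · rintro rfl; simp
  simp [this]

theorem diffCount_le_card_right (X Y : Finset G) (d : G) : diffCount X Y d ≤ #Y := by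
  rw [diffCount_eq_card_right]
  exact_mod_cast card_filter_le _ _

theorem diffCount_union_left {X₁ X₂ : Finset G} (h : Disjoint X₁ X₂) (Y : Finset G) (d : G) :
    diffCount (X₁ ∪ X₂) Y d = diffCount X₁ Y d + diffCount X₂ Y d := by
  unfold diffCount
  rw [sum_union h]

theorem diffCount_union_right {Y₁ Y₂ : Finset G} (h : Disjoint Y₁ Y₂) (X : Finset G) (d : G) :
    diffCount X (Y₁ ∪ Y₂) d = diffCount X Y₁ d + diffCount X Y₂ d := by
  unfold diffCount
  rw [← sum_add_distrib]
  exact sum_congr rfl fun _ _ => sum_union h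

theorem sum_diffCount_mul {X Y D : Finset G} (h : X - Y ⊆ D) (f : G → ℝ) :
    ∑ d ∈ D, diffCount X Y d * f d = ∑ x ∈ X, ∑ y ∈ Y, f (x - y) := by
  unfold diffCount
  simp_rw [sum_mul]
  rw [sum_comm]
  refine sum_congr rfl fun x hx => ?_
  rw [sum_comm]
  refine sum_congr rfl fun y hy => ?_
  simp [h (sub_mem_sub hx hy)]

theorem sum_diffCount_le (X Y D : Finset G) : ∑ d ∈ D, diffCount X Y d ≤ #X * #Y := by
  calc ∑ d ∈ D, diffCount X Y d ≤ ∑ d ∈ D ∪ (X - Y), diffCount X Y d :=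
        sum_le_sum_of_subset_of_nonneg subset_union_left fun _ _ _ => diffCount_nonneg _ _ _
    _ = ∑ d ∈ D ∪ (X - Y), diffCount X Y d * 1 := by simp
    _ = #X * #Y := by rw [sum_diffCount_mul subset_union_right]; simp

theorem sum_diffCount (X Y : Finset G) : ∑ d ∈ X - Y, diffCount X Y d = #X * #Y := by
  have := sum_diffCount_mul (X := X) (Y := Y) (D := X - Y) subset_rfl (fun _ => 1)
  simpa using this

theorem addEnergy_eq_sum_ite (X Y : Finset G) :
    (addEnergy X Y : ℝ) = ∑ a₁ ∈ X, ∑ a₂ ∈ X, ∑ b₁ ∈ Y, ∑ b₂ ∈ Y,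
      if a₁ - b₁ = a₂ - b₂ then (1 : ℝ) else 0 := by
  rw [addEnergy_eq_card_sub, card_filter]
  push_cast
  rw [sum_product, sum_product]
  simp_rw [sum_product]

theorem addEnergy_eq_sum_diffCount (X Y : Finset G) :
    (addEnergy X Y : ℝ) = ∑ x ∈ X, ∑ y ∈ Y, diffCount X Y (x - y) := by
  rw [addEnergy_eq_sum_ite]
  refine sum_congr rfl fun x _ => ?_
  rw [sum_comm]
  refine sum_congr rfl fun y _ => ?_
  simp_rw [diffCount, eq_comm]

theorem addEnergy_eq_sum_diffCount_self (X Y : Finset G) :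
    (addEnergy X Y : ℝ) = ∑ x₁ ∈ X, ∑ x₂ ∈ X, diffCount Y Y (x₁ - x₂) := by
  rw [addEnergy_eq_sum_ite]
  refine sum_congr rfl fun x₁ _ => sum_congr rfl fun x₂ _ => ?_
  unfold diffCount
  refine sum_congr rfl fun y₁ _ => sum_congr rfl fun y₂ _ => ?_
  have : (x₁ - y₁ = x₂ - y₂) ↔ (y₁ - y₂ = x₁ - x₂) := by
    rw [sub_eq_sub_iff_add_eq_add, sub_eq_sub_iff_add_eq_add, eq_comm, add_comm x₂]
  simp [this]

theorem addEnergy_eq_sum_sq_diffCount {X Y D : Finset G} (h : X - Y ⊆ D) :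
    (addEnergy X Y : ℝ) = ∑ d ∈ D, diffCount X Y d ^ 2 := by
  simp_rw [sq]
  rw [sum_diffCount_mul h, addEnergy_eq_sum_diffCount]

theorem addEnergy_eq_sum_mul_diffCount {X Y D : Finset G} (h : X - X ⊆ D) :
    (addEnergy X Y : ℝ) = ∑ d ∈ D, diffCount X X d * diffCount Y Y d := by
  rw [sum_diffCount_mul h, addEnergy_eq_sum_diffCount_self]

theorem addEnergy_le_of_diffCount_le {X Y : Finset G} {θ : ℝ} (h : ∀ d, diffCount X Y d ≤ θ) :
    (addEnergy X Y : ℝ) ≤ #X * #Y * θ := by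
  rw [addEnergy_eq_sum_diffCount]
  calc _ ≤ ∑ x ∈ X, ∑ y ∈ Y, θ := sum_le_sum fun _ _ => sum_le_sum fun _ _ => h _
    _ = _ := by simp [mul_assoc]

theorem addEnergy_le_card_mul_sq (X Y : Finset G) : (addEnergy X Y : ℝ) ≤ #X * #Y ^ 2 := by
  have := addEnergy_le_of_diffCount_le (diffCount_le_card_right X Y)
  linarith

theorem addEnergy_self_le (X : Finset G) : (addEnergy X X : ℝ) ≤ #X ^ 3 := by
  have := addEnergy_le_card_mul_sq X X
  linarith

/-- The energy is a sum of squares of counts additive in `X`, so `(a + b)² ≤ 2a² + 2b²` applies. -/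
theorem addEnergy_union_left_le {X₁ X₂ : Finset G} (h : Disjoint X₁ X₂) (Y : Finset G) :
    (addEnergy (X₁ ∪ X₂) Y : ℝ) ≤ 2 * addEnergy X₁ Y + 2 * addEnergy X₂ Y := by
  have h₁ : X₁ - Y ⊆ X₁ ∪ X₂ - Y := sub_subset_sub_right subset_union_left
  have h₂ : X₂ - Y ⊆ X₁ ∪ X₂ - Y := sub_subset_sub_right subset_union_right
  rw [addEnergy_eq_sum_sq_diffCount h₁, addEnergy_eq_sum_sq_diffCount h₂,
    addEnergy_eq_sum_sq_diffCount subset_rfl, mul_sum, mul_sum, ← sum_add_distrib]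
  refine sum_le_sum fun d _ => ?_
  rw [diffCount_union_left h]
  nlinarith [sq_nonneg (diffCount X₁ Y d - diffCount X₂ Y d)]

theorem addEnergy_union_right_le {Y₁ Y₂ : Finset G} (h : Disjoint Y₁ Y₂) (X : Finset G) :
    (addEnergy X (Y₁ ∪ Y₂) : ℝ) ≤ 2 * addEnergy X Y₁ + 2 * addEnergy X Y₂ := by
  simp_rw [addEnergy_comm X]
  exact addEnergy_union_left_le h X

/-- Write the count of the union as `u + v`, with `u = r_XX + r_YY` and `v = r_XY + r_YX`. Since `∑
r_XX r_YY = E(X,Y)`, the sum of `u²` is `E(X) + E(Y) + 2E(X,Y)`. The lower bound adds the two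
squares from `v²`. The upper bound expands `u² + 2v(u + v) - v²`: the terms `2E(X,Y)` cancel, and
Cauchy–Schwarz handles `v(u + v)`. -/
theorem addEnergy_union_self {X Y : Finset G} (h : Disjoint X Y) :
    (addEnergy X X : ℝ) + addEnergy Y Y + 4 * addEnergy X Y ≤ addEnergy (X ∪ Y) (X ∪ Y) ∧
      (addEnergy (X ∪ Y) (X ∪ Y) : ℝ) ≤ addEnergy X X + addEnergy Y Y +
        4 * √(addEnergy X Y * addEnergy (X ∪ Y) (X ∪ Y)) := by
  set D : Finset G := X ∪ Y - (X ∪ Y) with hD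
  have hXX : X - X ⊆ D := sub_subset_sub subset_union_left subset_union_left
  have hYY : Y - Y ⊆ D := sub_subset_sub subset_union_right subset_union_right
  have hXY : X - Y ⊆ D := sub_subset_sub subset_union_left subset_union_right
  have hYX : Y - X ⊆ D := sub_subset_sub subset_union_right subset_union_left
  have eU := addEnergy_eq_sum_sq_diffCount (X := X ∪ Y) (Y := X ∪ Y) (D := D) subset_rfl
  have eXX := addEnergy_eq_sum_sq_diffCount hXX
  have eYY := addEnergy_eq_sum_sq_diffCount hYY
  have eXY := addEnergy_eq_sum_sq_diffCount hXY
  have eYX := addEnergy_eq_sum_sq_diffCount hYX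
  rw [addEnergy_comm] at eYX
  have eP := addEnergy_eq_sum_mul_diffCount (Y := Y) hXX
  have hsplit : ∀ d, diffCount (X ∪ Y) (X ∪ Y) d = diffCount X X d + diffCount Y Y d +
      (diffCount X Y d + diffCount Y X d) := fun d => by
    rw [diffCount_union_left h, diffCount_union_right h, diffCount_union_right h]; ring
  have hpq : 0 ≤ ∑ d ∈ D, diffCount X Y d * diffCount Y X d :=
    sum_nonneg fun d _ => mul_nonneg (diffCount_nonneg _ _ _) (diffCount_nonneg _ _ _)
  constructor
  · have : (addEnergy X X : ℝ) + addEnergy Y Y + 2 * addEnergy X Y + addEnergy X Y + addEnergy X Y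
        ≤ addEnergy (X ∪ Y) (X ∪ Y) := by
      nth_rw 1 [eXX]; rw [eYY, eP, eU]
      rw [← eP]; nth_rw 2 [eXY]; nth_rw 2 [eYX]; rw [eP]
      rw [mul_sum, ← sum_add_distrib, ← sum_add_distrib, ← sum_add_distrib, ← sum_add_distrib]
      refine sum_le_sum fun d _ => ?_
      rw [hsplit]
      nlinarith [mul_nonneg (diffCount_nonneg X X d) (diffCount_nonneg X Y d),
        mul_nonneg (diffCount_nonneg X X d) (diffCount_nonneg Y X d),
        mul_nonneg (diffCount_nonneg Y Y d) (diffCount_nonneg X Y d),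
        mul_nonneg (diffCount_nonneg Y Y d) (diffCount_nonneg Y X d),
        mul_nonneg (diffCount_nonneg X Y d) (diffCount_nonneg Y X d)]
    linarith
  · have key : (addEnergy (X ∪ Y) (X ∪ Y) : ℝ) =
        addEnergy X X + addEnergy Y Y + 2 * addEnergy X Y - addEnergy X Y - addEnergy X Y
        + 2 * (∑ d ∈ D, diffCount X Y d * diffCount (X ∪ Y) (X ∪ Y) d)
        + 2 * (∑ d ∈ D, diffCount Y X d * diffCount (X ∪ Y) (X ∪ Y) d)
        - 2 * ∑ d ∈ D, diffCount X Y d * diffCount Y X d := by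
      nth_rw 1 [eXX]; rw [eYY]
      nth_rw 1 [eP]; nth_rw 1 [eXY]; rw [eYX, eU]
      simp_rw [mul_sum]
      rw [← sum_add_distrib, ← sum_add_distrib, ← sum_sub_distrib, ← sum_sub_distrib,
        ← sum_add_distrib, ← sum_add_distrib, ← sum_sub_distrib]
      refine sum_congr rfl fun d _ => ?_
      rw [hsplit]; ring
    have c₁ : ∑ d ∈ D, diffCount X Y d * diffCount (X ∪ Y) (X ∪ Y) d ≤
        √(addEnergy X Y * addEnergy (X ∪ Y) (X ∪ Y)) := by
      rw [Real.sqrt_mul (by positivity), eXY, eU]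
      exact Real.sum_mul_le_sqrt_mul_sqrt _ _ _
    have c₂ : ∑ d ∈ D, diffCount Y X d * diffCount (X ∪ Y) (X ∪ Y) d ≤
        √(addEnergy X Y * addEnergy (X ∪ Y) (X ∪ Y)) := by
      rw [Real.sqrt_mul (by positivity), eYX, eU]
      exact Real.sum_mul_le_sqrt_mul_sqrt _ _ _
    linarith

end EnergyBasics

/-! ### Optimal partitions for a weight on sets -/

section ExtremalPartition

variable {G : Type*} [DecidableEq G]

/-- `P` is a partition of `A` into nonempty parts. -/
structure IsSetPartition (A : Finset G) (P : Finset (Finset G)) : Prop where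
  disjoint : ∀ X ∈ P, ∀ Y ∈ P, X ≠ Y → Disjoint X Y
  nonempty : ∀ X ∈ P, X.Nonempty
  biUnion : P.biUnion id = A

theorem IsSetPartition.subset {A : Finset G} {P : Finset (Finset G)} (h : IsSetPartition A P)
    {X : Finset G} (hX : X ∈ P) : X ⊆ A := by
  rw [← h.biUnion]
  exact subset_biUnion_of_mem id hX

theorem IsSetPartition.sum_card {A : Finset G} {P : Finset (Finset G)} (h : IsSetPartition A P) :
    ∑ X ∈ P, #X = #A := by
  rw [← h.biUnion]
  exact (card_biUnion fun X hX Y hY => h.disjoint X hX Y hY).symm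

theorem isSetPartition_singleton {A : Finset G} (hA : A.Nonempty) : IsSetPartition A {A} where
  disjoint := by simp
  nonempty := by simpa
  biUnion := by simp

/-- A partition with a part `X₁ ∪ X₂` can be refined by splitting that part. -/
theorem IsSetPartition.split {A X₁ X₂ : Finset G} {P : Finset (Finset G)}
    (h : IsSetPartition A P) (hX : X₁ ∪ X₂ ∈ P) (hd : Disjoint X₁ X₂) (h₁ : X₁.Nonempty)
    (h₂ : X₂.Nonempty) :
    IsSetPartition A (insert X₁ (insert X₂ (P.erase (X₁ ∪ X₂)))) ∧
      X₁ ∉ insert X₂ (P.erase (X₁ ∪ X₂)) ∧ X₂ ∉ P.erase (X₁ ∪ X₂) := by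
  have hdis : ∀ Y ∈ P.erase (X₁ ∪ X₂), Disjoint X₁ Y ∧ Disjoint X₂ Y := fun Y hY => by
    rw [mem_erase] at hY
    exact disjoint_union_left.1 (h.disjoint _ hX _ hY.2 hY.1.symm)
  refine ⟨⟨?_, ?_, ?_⟩, ?_, ?_⟩
  · intro Y hY Z hZ hne
    simp only [mem_insert] at hY hZ
    rcases hY with rfl | rfl | hY <;> rcases hZ with rfl | rfl | hZ
    · exact absurd rfl hne
    · exact hd
    · exact (hdis _ hZ).1
    · exact hd.symm
    · exact absurd rfl hne
    · exact (hdis _ hZ).2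
    · exact (hdis _ hY).1.symm
    · exact (hdis _ hY).2.symm
    · exact h.disjoint _ (mem_of_mem_erase hY) _ (mem_of_mem_erase hZ) hne
  · intro Y hY
    simp only [mem_insert] at hY
    rcases hY with rfl | rfl | hY
    · exact h₁
    · exact h₂
    · exact h.nonempty _ (mem_of_mem_erase hY)
  · rw [biUnion_insert, biUnion_insert, ← union_assoc]
    conv_rhs => rw [← h.biUnion, ← insert_erase hX, biUnion_insert]
    rfl
  · rw [mem_insert, not_or]
    refine ⟨?_, fun hm => ?_⟩
    · rintro rfl
      exact h₁.ne_empty (disjoint_self.1 hd)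
    · exact h₁.ne_empty (disjoint_self.1 (hdis _ hm).1)
  · exact fun hm => h₂.ne_empty (disjoint_self.1 (hdis _ hm).2)

/-- Two parts of a partition can be merged. -/
theorem IsSetPartition.merge {A X Y : Finset G} {P : Finset (Finset G)}
    (h : IsSetPartition A P) (hX : X ∈ P) (hY : Y ∈ P) (hne : X ≠ Y) :
    IsSetPartition A (insert (X ∪ Y) ((P.erase X).erase Y)) ∧
      X ∪ Y ∉ (P.erase X).erase Y := by
  have hdis : ∀ Z ∈ (P.erase X).erase Y, Disjoint (X ∪ Y) Z := fun Z hZ => by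
    simp only [mem_erase] at hZ
    exact disjoint_union_left.2
      ⟨h.disjoint _ hX _ hZ.2.2 hZ.2.1.symm, h.disjoint _ hY _ hZ.2.2 hZ.1.symm⟩
  refine ⟨⟨?_, ?_, ?_⟩, fun hm => ?_⟩
  · intro Z hZ W hW hne'
    rw [mem_insert] at hZ hW
    rcases hZ with rfl | hZ <;> rcases hW with rfl | hW
    · exact absurd rfl hne'
    · exact hdis _ hW
    · exact (hdis _ hZ).symm
    · exact h.disjoint _ (mem_of_mem_erase (mem_of_mem_erase hZ)) _
        (mem_of_mem_erase (mem_of_mem_erase hW)) hne'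
  · intro Z hZ
    rw [mem_insert] at hZ
    rcases hZ with rfl | hZ
    · exact (h.nonempty _ hX).mono subset_union_left
    · exact h.nonempty _ (mem_of_mem_erase (mem_of_mem_erase hZ))
  · conv_rhs => rw [← h.biUnion, ← insert_erase hX, biUnion_insert,
      ← insert_erase (mem_erase.2 ⟨hne.symm, hY⟩), biUnion_insert, ← union_assoc]
    rw [biUnion_insert]
    rfl
  · exact ((h.nonempty _ hX).mono subset_union_left).ne_empty (disjoint_self.1 (hdis _ hm))

/-- Any weight function on sets admits an optimal partition: no splitting of a part, no merging of
two parts, and no passage to the trivial partition increases the total weight. -/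
theorem exists_optimal_partition {A : Finset G} (hA : A.Nonempty) (F : Finset G → ℝ) :
    ∃ P : Finset (Finset G), IsSetPartition A P ∧
      (∀ X₁ X₂ : Finset G, X₁ ∪ X₂ ∈ P → Disjoint X₁ X₂ → X₁.Nonempty → X₂.Nonempty →
        F X₁ + F X₂ ≤ F (X₁ ∪ X₂)) ∧
      (∀ X ∈ P, ∀ Y ∈ P, X ≠ Y → F (X ∪ Y) ≤ F X + F Y) ∧
      F A ≤ ∑ X ∈ P, F X := by
  classical
  have hmem : ∀ P, IsSetPartition A P → P ∈ A.powerset.powerset.filter (IsSetPartition A) :=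
    fun P hP => mem_filter.2 ⟨mem_powerset.2 fun X hX => mem_powerset.2 (hP.subset hX), hP⟩
  obtain ⟨P, hP, hmax⟩ := exists_max_image (A.powerset.powerset.filter (IsSetPartition A))
    (fun P => ∑ X ∈ P, F X) ⟨{A}, hmem _ (isSetPartition_singleton hA)⟩
  have hP := (mem_filter.1 hP).2
  refine ⟨P, hP, ?_, ?_, ?_⟩
  · intro X₁ X₂ hX hd h₁ h₂
    obtain ⟨hs, hn₁, hn₂⟩ := hP.split hX hd h₁ h₂
    have := hmax _ (hmem _ hs)
    rw [sum_insert hn₁, sum_insert hn₂, ← add_sum_erase _ _ hX] at this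
    linarith
  · intro X hX Y hY hne
    obtain ⟨hs, hn⟩ := hP.merge hX hY hne
    have := hmax _ (hmem _ hs)
    rw [sum_insert hn, ← add_sum_erase _ _ hX,
      ← add_sum_erase _ _ (mem_erase.2 ⟨hne.symm, hY⟩)] at this
    linarith
  · have := hmax _ (hmem _ (isSetPartition_singleton hA))
    simpa using this

end ExtremalPartition

/-! ### Increments of the penalty under splitting and merging -/

/-- The penalty attached to a part of size `x`; `s` is the square root of the total energy. -/
noncomputable def partPenalty (s x : ℝ) : ℝ := min (4 / 3 * x ^ 3) (4 * s * (x * √x))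

theorem partPenalty_nonneg {s x : ℝ} (hs : 0 ≤ s) (hx : 0 ≤ x) : 0 ≤ partPenalty s x :=
  le_min (by positivity) (by positivity)

/-- Bound both parts by the branch active on the union. The cubic branch gives `4xy(x + y)` exactly;
the other uses `y = c² - a² ≤ 2c(c - a)` with `c = √(x + y)`, `a = √x`, and its mirror image. The
two entries of the minimum match the two bounds `|C|³` and `E(A)` on the energy of a part `C`. -/
theorem partPenalty_split {s x y : ℝ} (hs : 0 ≤ s) (hx : 0 < x) (hy : 0 < y) :
    4 * (x * y) * min (x + y) (s / √(x + y)) ≤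
      partPenalty s (x + y) - partPenalty s x - partPenalty s y := by
  have h₁ : partPenalty s x ≤ 4 / 3 * x ^ 3 := min_le_left _ _
  have h₂ : partPenalty s y ≤ 4 / 3 * y ^ 3 := min_le_left _ _
  have h₃ : partPenalty s x ≤ 4 * s * (x * √x) := min_le_right _ _
  have h₄ : partPenalty s y ≤ 4 * s * (y * √y) := min_le_right _ _
  rcases min_choice (4 / 3 * (x + y) ^ 3) (4 * s * ((x + y) * √(x + y))) with h | h
  · have : 4 * (x * y) * min (x + y) (s / √(x + y)) ≤ 4 * (x * y) * (x + y) := by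
      gcongr; exact min_le_left _ _
    unfold partPenalty at *
    rw [h]
    linarith
  · have : 4 * (x * y) * min (x + y) (s / √(x + y)) ≤ 4 * (x * y) * (s / √(x + y)) := by
      gcongr; exact min_le_right _ _
    have key : x * y / √(x + y) ≤ (x + y) * √(x + y) - x * √x - y * √y := by
      have hc : 0 < √(x + y) := Real.sqrt_pos.2 (by linarith)
      have ha : √x ≤ √(x + y) := Real.sqrt_le_sqrt (by linarith)
      have hb : √y ≤ √(x + y) := Real.sqrt_le_sqrt (by linarith)
      have hc2 := Real.mul_self_sqrt (show 0 ≤ x + y by linarith)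
      have ha2 := Real.mul_self_sqrt hx.le
      have hb2 := Real.mul_self_sqrt hy.le
      rw [div_le_iff₀ hc]
      have e₁ : y ≤ 2 * (√(x + y) * (√(x + y) - √x)) := by
        nlinarith [mul_nonneg (sub_nonneg.2 ha) (sub_nonneg.2 ha)]
      have e₂ : x ≤ 2 * (√(x + y) * (√(x + y) - √y)) := by
        nlinarith [mul_nonneg (sub_nonneg.2 hb) (sub_nonneg.2 hb)]
      have := mul_le_mul_of_nonneg_left e₁ hx.le
      have := mul_le_mul_of_nonneg_left e₂ hy.le
      nlinarith
    have := mul_le_mul_of_nonneg_left key (show 0 ≤ 4 * s by positivity)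
    have e : 4 * s * (x * y / √(x + y)) = 4 * (x * y) * (s / √(x + y)) := by ring
    unfold partPenalty at *
    rw [h]
    linarith

/-- If both parts are on the cubic branch, bound the union by its cubic. Otherwise some part, of
size `x` say, has `3s ≤ x^(3/2)`; the other part's penalty is dropped, and the increment of the
`3/2` power is at most `3/2 · y√(x + y)`. -/
theorem partPenalty_merge {s x y : ℝ} (hs : 0 ≤ s) (hx : 0 < x) (hy : 0 < y) :
    partPenalty s (x + y) - partPenalty s x - partPenalty s y ≤ 4 * (x * y * (x + y)) := by
  have aux : ∀ {x y : ℝ}, 0 < x → 0 < y → 4 * s * (x * √x) ≤ 4 / 3 * x ^ 3 →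
      4 * s * ((x + y) * √(x + y)) - 4 * s * (x * √x) ≤ 4 * (x * y * (x + y)) := by
    intro x y hx hy h
    set c := √(x + y) with hcdef
    set a := √x with hadef
    have hc : 0 < c := Real.sqrt_pos.2 (by linarith)
    have ha0 : 0 < a := Real.sqrt_pos.2 hx
    have ha : a ≤ c := Real.sqrt_le_sqrt (by linarith)
    have hc2 : c * c = x + y := Real.mul_self_sqrt (show 0 ≤ x + y by linarith)
    have ha2 : a * a = x := Real.mul_self_sqrt hx.le
    have hy2 : y = c * c - a * a := by linarith
    have h3 : 3 * s ≤ a ^ 3 := by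
      have e : x ^ 3 = a ^ 3 * (x * a) := by rw [← ha2]; ring
      rw [e] at h
      have hxa : 0 < x * a := by positivity
      have : (3 * s) * (x * a) ≤ a ^ 3 * (x * a) := by linarith
      exact le_of_mul_le_mul_right this hxa
    have hd : (x + y) * c - x * a ≤ 3 / 2 * (y * c) := by
      rw [← hc2, hy2, ← ha2]
      have : 0 ≤ (c - a) * ((c - a) * (c + 2 * a)) := by
        have := sub_nonneg.2 ha
        positivity
      nlinarith
    have hd0 : 0 ≤ 3 / 2 * (y * c) := by positivity
    calc 4 * s * ((x + y) * c) - 4 * s * (x * a) = 4 / 3 * (3 * s) * ((x + y) * c - x * a) := by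
          ring
      _ ≤ 4 / 3 * (3 * s) * (3 / 2 * (y * c)) := by gcongr
      _ ≤ 4 / 3 * (a ^ 3) * (3 / 2 * (y * c)) := by gcongr
      _ = 2 * (a * a) * y * (a * c) := by ring
      _ ≤ 2 * (a * a) * y * (c * c) := by gcongr
      _ = 2 * (x * y * (x + y)) := by rw [ha2, hc2]; ring
      _ ≤ _ := by
        have : 0 < x * y * (x + y) := by positivity
        linarith
  have hl : partPenalty s (x + y) ≤ 4 / 3 * (x + y) ^ 3 := min_le_left _ _
  have hr : partPenalty s (x + y) ≤ 4 * s * ((x + y) * √(x + y)) := min_le_right _ _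
  have h₁ := partPenalty_nonneg hs hx.le
  have h₂ := partPenalty_nonneg hs hy.le
  rcases min_cases (4 / 3 * x ^ 3) (4 * s * (x * √x)) with ⟨e₁, _⟩ | ⟨e₁, g₁⟩
  · rcases min_cases (4 / 3 * y ^ 3) (4 * s * (y * √y)) with ⟨e₂, _⟩ | ⟨e₂, g₂⟩
    · have e₁ : partPenalty s x = _ := e₁
      have e₂ : partPenalty s y = _ := e₂
      rw [e₁, e₂]
      linarith
    · have e₂ : partPenalty s y = _ := e₂
      have := aux hy hx g₂.le
      rw [add_comm y x] at this
      rw [e₂]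
      linarith
  · have e₁ : partPenalty s x = _ := e₁
    have := aux hx hy g₁.le
    rw [e₁]
    linarith

/-! ### The energy decomposition -/

section Decomposition

variable {G : Type*} [AddCommGroup G] [DecidableEq G]

/-- `E(X, A)` sums a nonnegative function over `X × X`, and these squares are disjoint inside `A ×
A`. -/
theorem sum_addEnergy_le {A : Finset G} {Q : Finset (Finset G)} (hsub : ∀ X ∈ Q, X ⊆ A)
    (hdis : ∀ X ∈ Q, ∀ Y ∈ Q, X ≠ Y → Disjoint X Y) :
    ∑ X ∈ Q, (addEnergy X A : ℝ) ≤ addEnergy A A := by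
  have e : ∀ X : Finset G, (addEnergy X A : ℝ) = ∑ p ∈ X ×ˢ X, diffCount A A (p.1 - p.2) :=
    fun X => by rw [addEnergy_eq_sum_diffCount_self, sum_product]
  simp_rw [e]
  rw [← sum_biUnion (s := Q) (t := fun X => X ×ˢ X)
    fun X hX Y hY hne => disjoint_product.2 (Or.inl (hdis X hX Y hY hne))]
  refine sum_le_sum_of_subset_of_nonneg ?_ fun _ _ _ => diffCount_nonneg _ _ _
  exact biUnion_subset.2 fun X hX => product_subset_product (hsub X hX) (hsub X hX)

set_option maxHeartbeats 1000000 in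
/-- The energy decomposition with all conclusions except for the bound on the doubling. -/
theorem exists_energy_decomposition {A : Finset G} (hA : A.Nonempty) {K ε ω : ℝ} (hK : 0 < K)
    (hE : (addEnergy A A : ℝ) = (#A : ℝ) ^ 3 / K) (hε : 0 < ε) (hε' : ε ≤ 1 / 4) (hω : 0 < ω)
    (hω' : ω ≤ 1 / 4) :
    ∃ (Q : Finset (Finset G)) (Ω : Finset G),
      (∀ X ∈ Q, ∀ Y ∈ Q, X ≠ Y → Disjoint X Y) ∧
      (∀ X ∈ Q, Disjoint X Ω) ∧
      Q.biUnion id ∪ Ω = A ∧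
      (∀ X ∈ Q, √(ω / (2 * K)) * (#A : ℝ) ≤ #X) ∧
      (∀ X ∈ Q, energyStar X ≤ 4 * K * ((ω * ε) ^ 2)⁻¹) ∧
      (∀ X ∈ Q, ∀ Y ∈ Q, X ≠ Y → (addEnergy X Y : ℝ) ≤
        ε * ((#X : ℝ) ^ 2 * (#Y : ℝ) ^ 2 / (#A : ℝ))) ∧
      (addEnergy Ω A : ℝ) ≤ ω * (addEnergy A A : ℝ) := by
  set n : ℝ := (#A : ℝ) with hn
  have hn0 : 0 < n := by rw [hn]; exact_mod_cast hA.card_pos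
  set r : ℝ := √K with hr
  have hr0 : 0 < r := Real.sqrt_pos.2 hK
  have hr2 : r ^ 2 = K := Real.sq_sqrt hK.le
  set M : ℝ := 4 * K * ((ω * ε) ^ 2)⁻¹ with hM
  -- Balances three demands: `μ⁻² = M` for splitting, the factor `ε` for merging, and total penalty
  -- on `A` at most `2εω E(A)`.
  set μ : ℝ := ω * ε / (2 * r) with hμ
  have hμ0 : 0 < μ := by positivity
  have hMμ : M = (μ ^ 2)⁻¹ := by
    rw [hM, hμ, ← hr2]; field_simp; norm_num
  set s : ℝ := √(addEnergy A A : ℝ) with hs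
  have hs0 : 0 ≤ s := Real.sqrt_nonneg _
  have hs2 : s ^ 2 = addEnergy A A := Real.sq_sqrt (Nat.cast_nonneg _)
  have hsn : s = n * √n / r := by
    rw [hs, hE, Real.sqrt_div (by positivity), hr, show n ^ 3 = n ^ 2 * n by ring,
      Real.sqrt_mul (by positivity), Real.sqrt_sq hn0.le]
  obtain ⟨P, hP, hsplit, hmerge, htot⟩ := exists_optimal_partition hA
    fun X => (addEnergy X X : ℝ) - μ * partPenalty s #X
  -- Parts below this size have total energy at most `τ² n = (ω / 2) E(A)`.
  set τ : ℝ := √(ω / (2 * K)) * n with hτ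
  have hτ2 : τ ^ 2 = ω / (2 * K) * n ^ 2 := by
    rw [hτ, mul_pow, Real.sq_sqrt (by positivity)]
  have hτ0 : 0 ≤ τ := by positivity
  have hQP : ∀ X ∈ P.filter (fun X => τ ≤ #X), X ∈ P := fun X hX => (mem_filter.1 hX).1
  have hΩd : ∀ X ∈ P.filter (fun X => τ ≤ #X),
      Disjoint X ((P.filter (fun X => ¬ τ ≤ #X)).biUnion id) := by
    intro X hX
    rw [disjoint_biUnion_right]
    intro Y hY
    rw [mem_filter] at hX hY
    exact hP.disjoint _ hX.1 _ hY.1 fun h => hY.2 (by rw [← show X = Y from h]; exact hX.2)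
  refine ⟨P.filter (fun X => τ ≤ #X), (P.filter (fun X => ¬ τ ≤ #X)).biUnion id,
    fun X hX Y hY => hP.disjoint X (hQP X hX) Y (hQP Y hY), hΩd, ?_,
    fun X hX => (mem_filter.1 hX).2, ?_, ?_, ?_⟩
  · rw [← union_biUnion, filter_union_filter_not_eq, hP.biUnion]
  · intro C hC
    have hCP := hQP C hC
    refine sup'_le _ _ fun X hX => ?_
    have hXC := mem_powerset.1 hX
    rcases X.eq_empty_or_nonempty with rfl | hX0
    · simp only [card_empty, Nat.cast_zero]
      rw [zero_pow two_ne_zero, zero_mul, zero_div]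
      positivity
    rcases (C \ X).eq_empty_or_nonempty with h0 | hY0
    · rw [h0]
      simp only [card_empty, Nat.cast_zero]
      rw [zero_pow two_ne_zero, mul_zero, zero_div]
      positivity
    by_contra! hlt
    have hd : Disjoint X (C \ X) := disjoint_sdiff
    have hU : X ∪ C \ X = C := union_sdiff_of_subset hXC
    have hopt := hsplit X (C \ X) (by rwa [hU]) hd hX0 hY0
    have hup := (addEnergy_union_self hd).2
    have hcard : (#C : ℝ) = #X + #(C \ X) := by
      rw [← hU, card_union_of_disjoint hd, hU]; push_cast; rfl
    rw [hU] at hopt hup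
    set x : ℝ := (#X : ℝ)
    set y : ℝ := (#(C \ X) : ℝ)
    set e : ℝ := (addEnergy X (C \ X) : ℝ)
    have hx : 0 < x := Nat.cast_pos.2 hX0.card_pos
    have hy : 0 < y := Nat.cast_pos.2 hY0.card_pos
    have he : 0 < e := Nat.cast_pos.2 (addEnergy_pos hX0 hY0)
    have hC0 : C.Nonempty := hP.nonempty _ hCP
    have hEC : 0 < (addEnergy C C : ℝ) := by exact_mod_cast addEnergy_pos hC0 hC0
    rw [hcard, hMμ, lt_div_iff₀ (by positivity), inv_mul_lt_iff₀ (by positivity)] at hlt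
    have hpen := partPenalty_split hs0 hx hy
    rw [hcard] at hopt
    have h3 : (addEnergy C C : ℝ) ≤ (x + y) ^ 3 := hcard ▸ addEnergy_self_le C
    have h4 : (addEnergy C C : ℝ) ≤ s ^ 2 := by
      rw [hs2]; exact_mod_cast addEnergy_mono (hP.subset hCP) (hP.subset hCP)
    -- With `m` the minimum, `E(C) ≤ (x + y) m²`, while the assumed failure says `(x + y) e < μ² x²
    -- y²`. So the energy lost by splitting is below the penalty saved.
    have hsq : √(e * (addEnergy C C : ℝ)) < μ * ((x * y) * min (x + y) (s / √(x + y))) := by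
      have hmin0 : 0 ≤ min (x + y) (s / √(x + y)) := le_min (by positivity) (by positivity)
      rw [Real.sqrt_lt' ?_]
      · have hmin : (addEnergy C C : ℝ) ≤ (x + y) * min (x + y) (s / √(x + y)) ^ 2 := by
          rcases min_choice (x + y) (s / √(x + y)) with h | h
          · rw [h]; linarith
          · have hxy : 0 < x + y := by positivity
            rw [h, div_pow, Real.sq_sqrt hxy.le, mul_div_cancel₀ _ hxy.ne']
            exact h4
        calc e * (addEnergy C C : ℝ) ≤ e * ((x + y) * min (x + y) (s / √(x + y)) ^ 2) := by gcongr
          _ = ((x + y) * e) * min (x + y) (s / √(x + y)) ^ 2 := by ring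
          _ < (μ ^ 2 * (x ^ 2 * y ^ 2)) * min (x + y) (s / √(x + y)) ^ 2 := by
            refine mul_lt_mul_of_pos_right hlt ?_
            refine (sq_nonneg _).lt_of_ne fun h0 => ?_
            rw [← h0, mul_zero] at hmin
            linarith
          _ = _ := by ring
      · have hspos : 0 < s := Real.sqrt_pos.2 (by
          exact_mod_cast addEnergy_pos hA hA)
        have : 0 < min (x + y) (s / √(x + y)) := lt_min (by positivity) (by positivity)
        positivity
    have := mul_le_mul_of_nonneg_left hpen hμ0.le
    linarith
  · intro X hX Y hY hne
    have hopt := hmerge X (hQP X hX) Y (hQP Y hY) hne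
    have hd := hP.disjoint X (hQP X hX) Y (hQP Y hY) hne
    have hlow := (addEnergy_union_self hd).1
    have hcard : (#(X ∪ Y) : ℝ) = #X + #Y := by
      rw [card_union_of_disjoint hd]; push_cast; rfl
    have hx : (0 : ℝ) < #X := by exact_mod_cast (hP.nonempty _ (hQP X hX)).card_pos
    have hy : (0 : ℝ) < #Y := by exact_mod_cast (hP.nonempty _ (hQP Y hY)).card_pos
    have hxτ : τ ≤ #X := (mem_filter.1 hX).2
    have hyτ : τ ≤ #Y := (mem_filter.1 hY).2
    rw [hcard] at hopt
    set x : ℝ := (#X : ℝ)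
    set y : ℝ := (#Y : ℝ)
    have hpen := mul_le_mul_of_nonneg_left (partPenalty_merge hs0 hx hy) hμ0.le
    have he : (addEnergy X Y : ℝ) ≤ μ * (x * y * (x + y)) := by linarith
    -- Uses only `2ω ≤ 1`; it bounds `1/x + 1/y` for large parts and so turns `xy(x + y)` into `x²
    -- y² / n`.
    have hτω : ω * n / r ≤ τ := by
      refine abs_le_of_sq_le_sq' ?_ hτ0 |>.2
      rw [hτ2, div_pow, hr2, mul_pow, div_mul_eq_mul_div, div_le_div_iff₀ hK (by positivity)]
      have : 0 ≤ ω * n ^ 2 * K * (1 - 2 * ω) := by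
        have : 0 ≤ 1 - 2 * ω := by linarith
        positivity
      nlinarith
    have hxy : (x + y) * (ω * n / r) ≤ 2 * (x * y) := by
      nlinarith [mul_nonneg hx.le (sub_nonneg.2 (hτω.trans hyτ)),
        mul_nonneg hy.le (sub_nonneg.2 (hτω.trans hxτ))]
    refine he.trans ?_
    have : μ * (x * y * (x + y)) = ε * (x * y) / (2 * n) * ((x + y) * (ω * n / r)) := by
      rw [hμ]; field_simp
    rw [this]
    calc ε * (x * y) / (2 * n) * ((x + y) * (ω * n / r)) ≤ ε * (x * y) / (2 * n) * (2 * (x * y)) := by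
          gcongr
      _ = _ := by field_simp
  · set Ω := (P.filter (fun X => ¬ τ ≤ #X)).biUnion id with hΩ
    have hΩn : Ω ∉ P.filter (fun X => τ ≤ #X) := fun h =>
      (hP.nonempty _ (hQP _ h)).ne_empty (disjoint_self.1 (hΩd _ h))
    have hΩA : Ω ⊆ A := biUnion_subset.2 fun X hX => hP.subset (mem_filter.1 hX).1
    have h₁ := sum_addEnergy_le (A := A) (Q := insert Ω (P.filter (fun X => τ ≤ #X)))
      (by
        intro X hX
        rcases mem_insert.1 hX with rfl | hX
        · exact hΩA
        · exact hP.subset (hQP X hX))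
      (by
        intro X hX Y hY hne
        rcases mem_insert.1 hX with rfl | hX' <;> rcases mem_insert.1 hY with rfl | hY'
        · exact absurd rfl hne
        · exact (hΩd _ hY').symm
        · exact hΩd _ hX'
        · exact hP.disjoint X (hQP X hX') Y (hQP Y hY') hne)
    rw [sum_insert hΩn] at h₁
    have h₂ : ∑ X ∈ P.filter (fun X => τ ≤ #X), (addEnergy X X : ℝ) ≤
        ∑ X ∈ P.filter (fun X => τ ≤ #X), (addEnergy X A : ℝ) :=
      sum_le_sum fun X hX => by
        exact_mod_cast addEnergy_mono subset_rfl (hP.subset (hQP X hX))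
    have h₃ := sum_filter_add_sum_filter_not P (fun X => τ ≤ #X) fun X => (addEnergy X X : ℝ)
    have h₄ : (addEnergy A A : ℝ) - μ * partPenalty s n ≤ ∑ X ∈ P, (addEnergy X X : ℝ) := by
      refine htot.trans (sum_le_sum fun X _ => ?_)
      have := mul_nonneg hμ0.le (partPenalty_nonneg hs0 (Nat.cast_nonneg (α := ℝ) #X))
      linarith
    -- The `3/2`-power branch matters here: it costs `4 s n^(3/2) = 4√K · E(A)`, and `ε ≤ 1/4`
    -- finishes.
    have h₅ : μ * partPenalty s n ≤ ω / 2 * (addEnergy A A : ℝ) := by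
      calc μ * partPenalty s n ≤ μ * (4 * s * (n * √n)) := by
            gcongr; exact min_le_right _ _
        _ = 2 * ε * ω * (n ^ 2 * √n ^ 2 / r ^ 2) := by rw [hsn, hμ]; field_simp; ring
        _ = 2 * ε * ω * (addEnergy A A : ℝ) := by
            rw [Real.sq_sqrt hn0.le, hr2, hE]; ring
        _ ≤ _ := by
            have : 0 ≤ ω * (addEnergy A A : ℝ) := by positivity
            nlinarith
    have h₆ : ∑ X ∈ P.filter (fun X => ¬ τ ≤ #X), (addEnergy X X : ℝ) ≤
        ω / 2 * (addEnergy A A : ℝ) := by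
      calc ∑ X ∈ P.filter (fun X => ¬ τ ≤ #X), (addEnergy X X : ℝ)
          ≤ ∑ X ∈ P.filter (fun X => ¬ τ ≤ #X), τ ^ 2 * (#X : ℝ) := by
            refine sum_le_sum fun X hX => (addEnergy_self_le X).trans ?_
            have := (not_le.1 (mem_filter.1 hX).2).le
            rw [pow_succ]
            gcongr
        _ ≤ ∑ X ∈ P, τ ^ 2 * (#X : ℝ) :=
            sum_le_sum_of_subset_of_nonneg (filter_subset _ _) fun _ _ _ => by positivity
        _ = τ ^ 2 * n := by
            rw [← mul_sum, hn, ← hP.sum_card]; push_cast; rfl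
        _ = _ := by rw [hτ2, hE]; field_simp
    linarith

end Decomposition

/-! ### A Balog–Szemerédi–Gowers theorem -/

section BalogSzemerediGowers

variable {G : Type*} [AddCommGroup G] [DecidableEq G]

theorem sum_diffCount_sub_left_le (X Y D : Finset G) (u : G) :
    ∑ d ∈ D, diffCount X Y (u - d) ≤ #X * #Y := by
  rw [← sum_image (g := fun d => u - d) (f := fun d => diffCount X Y d)
    fun a _ b _ h => sub_right_injective h]
  exact sum_diffCount_le _ _ _

/-- The pairs in the sets `A ∩ (A + s)` whose difference is unpopular are rare on average. -/
theorem sum_unpopular_pairs_le (A D : Finset G) {θ : ℝ} (hθ : 0 ≤ θ) :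
    ∑ s ∈ D, ∑ a ∈ A with a - s ∈ A, ∑ b ∈ A with b - s ∈ A,
      (if diffCount A A (a - b) < θ then (1 : ℝ) else 0) ≤ θ * #A ^ 2 := by
  simp_rw [sum_filter]
  rw [sum_comm]
  have hb : ∀ a ∈ A, ∀ b ∈ A, (∑ s ∈ D, if a - s ∈ A then (if b - s ∈ A then
      (if diffCount A A (a - b) < θ then (1 : ℝ) else 0) else 0) else 0) ≤ θ := by
    intro a _ b _
    by_cases h : diffCount A A (a - b) < θ
    · simp only [if_pos h, ← ite_and]
      refine le_trans ?_ h.le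
      rw [diffCount_eq_card_right, ← sum_filter, sum_const, nsmul_eq_mul, mul_one]
      norm_cast
      -- Each `s` counted gives a representation of `a - b` as `(a - s) - (b - s)`, and there are
      -- fewer than `θ` of these.
      refine card_le_card_of_injOn (fun s => b - s) ?_ fun x _ y _ h => sub_right_injective h
      intro s hs
      simp only [coe_filter, Set.mem_ofPred_eq] at hs ⊢
      exact ⟨hs.2.2, by rw [show b - s + (a - b) = a - s by abel]; exact hs.2.1⟩
    · simpa [h] using hθ
  calc _ = ∑ a ∈ A, ∑ b ∈ A, (∑ s ∈ D, if a - s ∈ A then (if b - s ∈ A then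
      (if diffCount A A (a - b) < θ then (1 : ℝ) else 0) else 0) else 0) := by
        refine sum_congr rfl fun a _ => ?_
        rw [sum_comm]
        refine sum_congr rfl fun s _ => ?_
        split_ifs <;> simp
    _ ≤ ∑ a ∈ A, ∑ b ∈ A, θ := sum_le_sum fun a ha => sum_le_sum fun b hb' => hb a ha b hb'
    _ = _ := by simp; ring

/-- A form of the **Balog–Szemerédi–Gowers theorem** with explicit constants. -/
theorem exists_subset_small_difference {A : Finset G} (hA : A.Nonempty) {κ : ℝ} (hκ : 0 < κ)
    (hE : (#A : ℝ) ^ 3 / κ ≤ addEnergy A A) :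
    ∃ X ⊆ A, (#A : ℝ) / (4 * κ) ≤ #X ∧ (#(X - X) : ℝ) ≤ 1024 * κ ^ 3 * #A := by
  set n : ℝ := (#A : ℝ) with hn
  have hn0 : 0 < n := Nat.cast_pos.2 hA.card_pos
  set θ : ℝ := n / (16 * κ) with hθ
  have hθ0 : 0 < θ := by positivity
  set r := diffCount A A with hr
  set B : G → Finset G := fun s => A.filter fun a => a - s ∈ A with hB
  have hBr : ∀ s, (#(B s) : ℝ) = r s := fun s => (diffCount_eq_card_left A A s).symm
  set bad : G → G → ℝ := fun a b => if r (a - b) < θ then 1 else 0 with hbad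
  have hsum := sum_unpopular_pairs_le A (A - A) hθ0.le
  -- Averaging over `s`: `∑ r² ≥ n³/κ`, and the choice of `θ` makes the two subtracted terms at most
  -- `n³/(2κ)` each. The last term forces `r s` to be large.
  obtain ⟨s, hs, hpos⟩ : ∃ s ∈ A - A, 0 ≤ r s ^ 2 -
      8 * (∑ a ∈ B s, ∑ b ∈ B s, bad a b) - n / (2 * κ) * r s := by
    refine exists_le_of_sum_le (f := fun _ => (0 : ℝ)) (hA.sub hA) ?_
    rw [sum_const_zero, sum_sub_distrib, sum_sub_distrib, ← mul_sum, ← mul_sum,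
      ← addEnergy_eq_sum_sq_diffCount subset_rfl, sum_diffCount]
    have : θ * n ^ 2 * 8 + n / (2 * κ) * (n * n) = n ^ 3 / κ := by
      rw [hθ]; field_simp; norm_num
    linarith
  set β : ℝ := r s with hβ
  have hβ0 : 0 < β := by
    obtain ⟨a, ha, b, hb, rfl⟩ := mem_sub.1 hs
    rw [hβ, ← hBr]
    exact Nat.cast_pos.2 (card_pos.2 ⟨a, by simp [hB, ha, hb]⟩)
  have hbad0 : ∀ a b, 0 ≤ bad a b := fun a b => by simp only [hbad]; split_ifs <;> norm_num
  have hbadsum0 : 0 ≤ ∑ a ∈ B s, ∑ b ∈ B s, bad a b :=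
    sum_nonneg fun _ _ => sum_nonneg fun _ _ => hbad0 _ _
  have hβn : n / (2 * κ) ≤ β := by
    have : n / (2 * κ) * β ≤ β * β := by linarith
    exact le_of_mul_le_mul_right this hβ0
  have hbad8 : 8 * (∑ a ∈ B s, ∑ b ∈ B s, bad a b) ≤ β ^ 2 := by
    have : 0 ≤ n / (2 * κ) * β := by positivity
    linarith
  set X := (B s).filter fun a => ∑ b ∈ B s, bad a b ≤ β / 4 with hX
  have hcompl : (#((B s).filter fun a => ¬ ∑ b ∈ B s, bad a b ≤ β / 4) : ℝ) ≤ β / 2 := by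
    have : (#((B s).filter fun a => ¬ ∑ b ∈ B s, bad a b ≤ β / 4) : ℝ) * (β / 4) ≤
        ∑ a ∈ B s, ∑ b ∈ B s, bad a b := by
      rw [← nsmul_eq_mul]
      refine (card_nsmul_le_sum _ (fun a => ∑ b ∈ B s, bad a b) _ fun a ha =>
        (not_le.1 (mem_filter.1 ha).2).le).trans ?_
      exact sum_le_sum_of_subset_of_nonneg (filter_subset _ _) fun a _ _ =>
        sum_nonneg fun _ _ => hbad0 _ _
    nlinarith
  have hXcard : β / 2 ≤ #X := by
    have := card_filter_add_card_filter_not (s := B s) (fun a => ∑ b ∈ B s, bad a b ≤ β / 4)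
    have h' : (#X : ℝ) + #((B s).filter fun a => ¬ ∑ b ∈ B s, bad a b ≤ β / 4) = #(B s) := by
      exact_mod_cast this
    rw [hBr] at h'
    linarith
  have hBA : B s ⊆ A := filter_subset _ _
  have hXB : X ⊆ B s := filter_subset _ _
  refine ⟨X, hXB.trans hBA, ?_, ?_⟩
  · have : n / (4 * κ) = n / (2 * κ) / 2 := by field_simp; norm_num
    linarith
  have hr0 : ∀ d, 0 ≤ r d := diffCount_nonneg A A
  -- At least half of `b ∈ B s` make both `a - b` and `a' - b` popular, and `a - a' = (a - b) - (a'
  -- - b)`. So `d` has many representations by quadruples from `A`, of which there are `n⁴`.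
  have hrep : ∀ d ∈ X - X, β / 2 * θ ^ 2 ≤ ∑ u ∈ A - A, r u * r (u - d) := by
    intro d hd
    obtain ⟨a, ha, a', ha', rfl⟩ := mem_sub.1 hd
    set good := (B s).filter fun b => θ ≤ r (a - b) ∧ θ ≤ r (a' - b) with hgood
    have hcard : β ≤ #good + ∑ b ∈ B s, bad a b + ∑ b ∈ B s, bad a' b := by
      rw [hβ, ← hBr, card_eq_sum_ones (B s), hgood, card_filter _ (B s), Nat.cast_sum,
        Nat.cast_sum, ← sum_add_distrib, ← sum_add_distrib]
      push_cast
      refine sum_le_sum fun b _ => ?_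
      simp only [hbad]
      by_cases h₁ : r (a - b) < θ
      · rw [if_pos h₁]
        have : (0 : ℝ) ≤ if r (a' - b) < θ then 1 else 0 := by split_ifs <;> norm_num
        have : (0 : ℝ) ≤ if θ ≤ r (a - b) ∧ θ ≤ r (a' - b) then 1 else 0 := by
          split_ifs <;> norm_num
        linarith
      · by_cases h₂ : r (a' - b) < θ
        · rw [if_neg h₁, if_pos h₂]
          have : (0 : ℝ) ≤ if θ ≤ r (a - b) ∧ θ ≤ r (a' - b) then 1 else 0 := by
            split_ifs <;> norm_num
          linarith
        · rw [if_neg h₁, if_neg h₂, if_pos ⟨not_lt.1 h₁, not_lt.1 h₂⟩]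
          norm_num
    have ha4 := (mem_filter.1 ha).2
    have ha4' := (mem_filter.1 ha').2
    have hgc : β / 2 ≤ #good := by linarith
    calc β / 2 * θ ^ 2 ≤ #good * θ ^ 2 := by gcongr
      _ = ∑ b ∈ good, θ * θ := by rw [sum_const, nsmul_eq_mul, sq]
      _ ≤ ∑ b ∈ good, r (a - b) * r (a' - b) := by
          refine sum_le_sum fun b hb => ?_
          have := (mem_filter.1 hb).2
          exact mul_le_mul this.1 this.2 hθ0.le (hr0 _)
      _ = ∑ b ∈ good, r (a - b) * r (a - b - (a - a')) := by
          refine sum_congr rfl fun b _ => ?_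
          rw [show a - b - (a - a') = a' - b by abel]
      _ = ∑ u ∈ good.image (fun b => a - b), r u * r (u - (a - a')) :=
          (sum_image (f := fun u => r u * r (u - (a - a')))
            fun x _ y _ h => sub_right_injective h).symm
      _ ≤ _ := by
          refine sum_le_sum_of_subset_of_nonneg ?_ fun _ _ _ => mul_nonneg (hr0 _) (hr0 _)
          intro u hu
          obtain ⟨b, hb, rfl⟩ := mem_image.1 hu
          exact sub_mem_sub (hBA (hXB ha)) (hBA (mem_filter.1 hb).1)
  have htotal : (#(X - X) : ℝ) * (β / 2 * θ ^ 2) ≤ n ^ 4 := by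
    calc (#(X - X) : ℝ) * (β / 2 * θ ^ 2) = ∑ d ∈ X - X, β / 2 * θ ^ 2 := by
          rw [sum_const, nsmul_eq_mul]
      _ ≤ ∑ d ∈ X - X, ∑ u ∈ A - A, r u * r (u - d) := sum_le_sum hrep
      _ = ∑ u ∈ A - A, r u * ∑ d ∈ X - X, r (u - d) := by
          rw [sum_comm]; simp_rw [mul_sum]
      _ ≤ ∑ u ∈ A - A, r u * (n * n) := by
          refine sum_le_sum fun u _ => ?_
          have := sum_diffCount_sub_left_le A A (X - X) u
          exact mul_le_mul_of_nonneg_left this (hr0 u)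
      _ = n ^ 4 := by
          rw [← sum_mul, sum_diffCount]; ring
  have hlow : n ^ 3 / (1024 * κ ^ 3) ≤ β / 2 * θ ^ 2 := by
    calc n ^ 3 / (1024 * κ ^ 3) = n / (2 * κ) / 2 * θ ^ 2 := by
          rw [hθ]; field_simp; norm_num
      _ ≤ _ := by gcongr
  have : (#(X - X) : ℝ) * (n ^ 3 / (1024 * κ ^ 3)) ≤ n ^ 4 :=
    (mul_le_mul_of_nonneg_left hlow (Nat.cast_nonneg _)).trans htotal
  rw [← mul_div_assoc, div_le_iff₀ (by positivity)] at this
  have h3 : 0 < n ^ 3 := by positivity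
  refine le_of_mul_le_mul_right (this.trans_eq ?_) h3
  ring

end BalogSzemerediGowers

/-! ### Growing a subset when every cut has large energy -/

section Growth

variable {G : Type*} [AddCommGroup G] [DecidableEq G]

theorem card_sq_mul_card_sq_le_of_energyStar_le {A X : Finset G} {M : ℝ}
    (h : energyStar A ≤ M) (hX : X ⊆ A) :
    (#X : ℝ) ^ 2 * #(A \ X) ^ 2 ≤ M * #A * addEnergy X (A \ X) := by
  rcases X.eq_empty_or_nonempty with rfl | hX0
  · simp
  rcases (A \ X).eq_empty_or_nonempty with h0 | hY0
  · simp [h0]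
  have hA : (0 : ℝ) < #A := Nat.cast_pos.2 (hX0.mono hX).card_pos
  have hE : (0 : ℝ) < addEnergy X (A \ X) := Nat.cast_pos.2 (addEnergy_pos hX0 hY0)
  have := (le_sup' (fun X => ((#X : ℝ) ^ 2 * (#(A \ X) : ℝ) ^ 2) /
    ((#A : ℝ) * (addEnergy X (A \ X) : ℝ))) (mem_powerset.2 hX)).trans h
  rw [div_le_iff₀ (by positivity)] at this
  linarith

/-- Greedy removal from `Z` of the points lying in few translates of `X` leaves a set which has a
small intersection with each translate of `X`. -/
theorem exists_greedy_translates (X : Finset G) {θ : ℝ} (hθ : 0 < θ) (Z : Finset G) :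
    ∃ T Z' : Finset G, Z' ⊆ Z ∧ (#T : ℝ) * θ ≤ #Z ∧ Z \ Z' ⊆ X + T ∧
      ∀ d, diffCount X Z' d ≤ θ := by
  induction hm : #Z using Nat.strong_induction_on generalizing Z with
  | _ m ih =>
    by_cases hall : ∀ d, diffCount X Z d ≤ θ
    · exact ⟨∅, Z, subset_rfl, by simp, by simp, hall⟩
    push Not at hall
    obtain ⟨d, hd⟩ := hall
    rw [diffCount_eq_card_right] at hd
    have hcard := card_filter_add_card_filter_not (s := Z) (fun y => y + d ∈ X)
    have hpos : 0 < #{y ∈ Z | y + d ∈ X} := by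
      have : (0 : ℝ) < #{y ∈ Z | y + d ∈ X} := hθ.trans hd
      exact_mod_cast this
    obtain ⟨T, Z', hsub, hT, hcov, hle⟩ := ih #{y ∈ Z | ¬ y + d ∈ X} (by omega) _ rfl
    -- The points removed at this stage lie in the translate `X - d`, and there are more than `θ` of
    -- them.
    refine ⟨insert (-d) T, Z', hsub.trans (filter_subset _ _), ?_, ?_, hle⟩
    · have h₁ : (#(insert (-d) T) : ℝ) ≤ #T + 1 := by exact_mod_cast card_insert_le _ _
      have h₂ : (#{y ∈ Z | y + d ∈ X} : ℝ) + #{y ∈ Z | ¬ y + d ∈ X} = m := by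
        rw [← hm]; exact_mod_cast hcard
      nlinarith [mul_le_mul_of_nonneg_right h₁ hθ.le]
    · intro y hy
      rw [mem_sdiff] at hy
      by_cases hyd : y + d ∈ X
      · exact mem_add.2 ⟨y + d, hyd, -d, mem_insert_self _ _, by abel⟩
      · exact add_subset_add_left (subset_insert _ _)
          (hcov (mem_sdiff.2 ⟨mem_filter.2 ⟨hy.1, hyd⟩, hy.2⟩))

/-- Enlarging `X ⊆ A` by few translates decouples it from the rest of `A`. -/
theorem exists_decoupled_extension {A X : Finset G} (hX : X ⊆ A) (hX0 : X.Nonempty) {M N : ℝ}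
    (hM : 0 < M) (hN : 16 * M * #A / #X + 1 ≤ N) :
    ∃ X' T : Finset G, X ⊆ X' ∧ X' ⊆ A ∧ X' ⊆ X + T ∧ (#T : ℝ) ≤ N ∧
      16 * M * #A * (addEnergy X (A \ X') : ℝ) ≤ #X ^ 2 * #(A \ X) * #(A \ X') := by
  have hx : (0 : ℝ) < #X := Nat.cast_pos.2 hX0.card_pos
  have hn : (0 : ℝ) < #A := Nat.cast_pos.2 (hX0.mono hX).card_pos
  have hsub0 : ∀ T : Finset G, X ⊆ X + insert 0 T := fun T x hx =>
    mem_add.2 ⟨x, hx, 0, mem_insert_self _ _, add_zero x⟩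
  rcases (A \ X).eq_empty_or_nonempty with h0 | hY0
  · refine ⟨X, {0}, subset_rfl, hX, fun a ha =>
      mem_add.2 ⟨a, ha, 0, mem_singleton_self _, add_zero a⟩, ?_, by simp [h0]⟩
    have : 0 ≤ 16 * M * #A / #X := by positivity
    rw [card_singleton, Nat.cast_one]
    linarith
  have hy : (0 : ℝ) < #(A \ X) := Nat.cast_pos.2 hY0.card_pos
  -- Makes `|X| |Z| θ` the required energy bound and `|A \ X| / θ = 16M|A| / |X|` the number of
  -- translates; the extra translate by `0` covers `X` itself.
  set θ : ℝ := #X * #(A \ X) / (16 * M * #A) with hθ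
  have hθ0 : 0 < θ := by positivity
  obtain ⟨T, Z, hZ, hT, hcov, hle⟩ := exists_greedy_translates X hθ0 (A \ X)
  have hZA : Z ⊆ A := hZ.trans sdiff_subset
  have hXZ : Disjoint X Z := disjoint_of_subset_right hZ disjoint_sdiff
  refine ⟨A \ Z, insert 0 T, subset_sdiff.2 ⟨hX, hXZ⟩, sdiff_subset, ?_, ?_, ?_⟩
  · intro a ha
    rw [mem_sdiff] at ha
    by_cases haX : a ∈ X
    · exact hsub0 T haX
    · exact add_subset_add_left (subset_insert _ _)
        (hcov (mem_sdiff.2 ⟨mem_sdiff.2 ⟨ha.1, haX⟩, ha.2⟩))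
  · have h₁ : (#(insert 0 T) : ℝ) ≤ #T + 1 := by exact_mod_cast card_insert_le _ _
    have h₂ : (#T : ℝ) ≤ 16 * M * #A / #X := by
      rw [le_div_iff₀ hx]
      rw [hθ, ← mul_div_assoc, div_le_iff₀ (by positivity)] at hT
      have : #T * (#X : ℝ) * #(A \ X) ≤ 16 * M * #A * #(A \ X) := by linarith
      exact le_of_mul_le_mul_right this hy
    linarith
  · rw [Finset.sdiff_sdiff_eq_self hZA]
    have := addEnergy_le_of_diffCount_le hle
    calc 16 * M * #A * (addEnergy X Z : ℝ) ≤ 16 * M * #A * (#X * #Z * θ) := by gcongr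
      _ = _ := by rw [hθ]; field_simp

/-- This trivial cubic bound between consecutive layers is the source of the exponent `1/3` in the
growth rate. -/
theorem addEnergy_sdiff_le_cube {X X' X'' : Finset G} (h : X ⊆ X') (h' : X' ⊆ X'') :
    (addEnergy (X' \ X) (X'' \ X') : ℝ) ≤ ((#X'' : ℝ) - #X) ^ 3 := by
  have e₁ := card_sdiff_add_card_eq_card h
  have e₂ := card_sdiff_add_card_eq_card h'
  have e : (#X'' : ℝ) - #X = #(X' \ X) + #(X'' \ X') := by
    rw [← e₂, ← e₁]; push_cast; ring
  rw [e]
  refine (addEnergy_le_card_mul_sq _ _).trans ?_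
  have ha : (0 : ℝ) ≤ #(X' \ X) := Nat.cast_nonneg _
  have hb : (0 : ℝ) ≤ #(X'' \ X') := Nat.cast_nonneg _
  generalize (#(X' \ X) : ℝ) = a at ha ⊢
  generalize (#(X'' \ X') : ℝ) = b at hb ⊢
  have : 0 ≤ a ^ 3 + 3 * a ^ 2 * b + 2 * a * b ^ 2 + b ^ 3 := by positivity
  nlinarith

/-- The numerical core of `ratio_growth`. -/
theorem ratio_growth_of_energy_bounds {n x x' x'' y y' y'' M η e e₁ e₂ e₃ : ℝ} (hn : 0 < n)
    (hM : 0 < M) (hη : 0 ≤ η) (hη1 : η ≤ 1) (hηM : 128 * M * η ^ 3 ≤ 1) (hx : 0 < x)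
    (hxx' : x ≤ x') (hxx'' : x' ≤ x'') (hy0 : 0 ≤ y'') (hy' : y'' ≤ y') (hy : y' ≤ y)
    (c₁ : y + x = n) (c₂ : y'' + x'' = n)
    (hcon : x' ^ 2 * y' ^ 2 ≤ M * n * e) (he : e ≤ 2 * e₁ + 4 * e₂ + 4 * e₃)
    (h₁ : 16 * M * n * e₁ ≤ x ^ 2 * y * y') (h₂ : e₂ ≤ (x'' - x) ^ 3)
    (h₃ : 16 * M * n * e₃ ≤ x' ^ 2 * y' * y'') :
    (1 + η) * (x * y'') ≤ x'' * y := by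
  have hy'0 : 0 ≤ y' := hy0.trans hy'
  have hyy0 : 0 ≤ y := hy'0.trans hy
  have hx'0 : 0 < x' := hx.trans_le hxx'
  -- If the complement more than halves, the ratio at least doubles.
  rcases lt_or_ge (2 * y'') y with hhalf | hhalf
  · calc (1 + η) * (x * y'') ≤ 2 * (x * y'') := by gcongr; linarith
      _ = x * (2 * y'') := by ring
      _ ≤ x'' * y := mul_le_mul (hxx'.trans hxx'') hhalf.le (by positivity) (by linarith)
  obtain ⟨l, hl⟩ : ∃ l, l = x'' - x := ⟨_, rfl⟩
  have hl0 : 0 ≤ l := by linarith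
  rw [← hl] at h₂
  have ex : x'' = x + l := by linarith
  have ey : y'' = y - l := by linarith
  -- The decoupled terms `e₁`, `e₃` absorb at most half of `x'² y'²`, so the middle energy, at most
  -- `l³`, must supply the rest.
  have hlarge : x ^ 2 * y ^ 2 ≤ 32 * M * n * l ^ 3 := by
    have i₁ : x ^ 2 * y * y' ≤ 2 * (x' ^ 2 * y' ^ 2) := by
      calc x ^ 2 * y * y' ≤ x' ^ 2 * (2 * y') * y' := by
            gcongr; linarith
        _ = _ := by ring
    have i₂ : x' ^ 2 * y' * y'' ≤ x' ^ 2 * y' ^ 2 := by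
      calc x' ^ 2 * y' * y'' ≤ x' ^ 2 * y' * y' := by gcongr
        _ = _ := by ring
    have i₃ : M * n * e ≤ M * n * (2 * e₁ + 4 * e₂ + 4 * e₃) := by gcongr
    have i₄ : M * n * e₂ ≤ M * n * l ^ 3 := by gcongr
    have i₅ : x ^ 2 * y ^ 2 ≤ x' ^ 2 * (2 * y') ^ 2 := by
      gcongr; linarith
    linarith
  -- Taken at `m = min x y`, where `mn ≤ 2xy`; the previous bound becomes `m³ ≤ 128 M l³`.
  have hlower : ∀ m : ℝ, 0 ≤ m → m ≤ x → m ≤ y → η * m ≤ l := by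
    intro m hm hmx hmy
    have hprod : m * n ≤ 2 * (x * y) := by
      rw [← c₁]
      linarith [mul_le_mul_of_nonneg_right hmx hyy0, mul_le_mul_of_nonneg_left hmy hx.le]
    have hsq : (m * n) ^ 2 ≤ (2 * (x * y)) ^ 2 := by gcongr
    have hm3 : m ^ 2 * n ≤ 128 * M * l ^ 3 := by
      have : m ^ 2 * n * n ≤ 128 * M * l ^ 3 * n := by linarith
      exact le_of_mul_le_mul_right this hn
    have hm3' : m ^ 3 ≤ 128 * M * l ^ 3 := by
      refine le_trans ?_ hm3
      rw [pow_succ]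
      gcongr
      linarith
    have h3 : (η * m) ^ 3 ≤ l ^ 3 := by
      calc (η * m) ^ 3 = η ^ 3 * m ^ 3 := by ring
        _ ≤ η ^ 3 * (128 * M * l ^ 3) := by gcongr
        _ = 128 * M * η ^ 3 * l ^ 3 := by ring
        _ ≤ 1 * l ^ 3 := by gcongr
        _ = l ^ 3 := one_mul _
    exact le_of_pow_le_pow_left₀ three_ne_zero hl0 h3
  rcases le_total x y with hle | hle
  · have := hlower x hx.le le_rfl hle
    calc (1 + η) * (x * y'') = (x + η * x) * y'' := by ring
      _ ≤ x'' * y := mul_le_mul (by linarith) (by linarith) hy0 (by linarith)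
  · have := hlower y hyy0 hle le_rfl
    have h1 : (1 + η) * y'' ≤ y := by
      rw [ey]
      have : 0 ≤ η * η * y := by positivity
      have : 0 ≤ (1 + η) * (l - η * y) := mul_nonneg (by linarith) (by linarith)
      nlinarith
    calc (1 + η) * (x * y'') = x * ((1 + η) * y'') := by ring
      _ ≤ x'' * y := mul_le_mul (by linarith) h1 (by positivity) (by linarith)

/-- If `X'` is energetically connected to its complement, then two decoupled extensions enlarge
the ratio `|X| / |A \ X|` by a definite factor. -/
theorem ratio_growth {A X X' X'' : Finset G} {M η : ℝ} (hM : 0 < M) (hη : 0 ≤ η) (hη1 : η ≤ 1)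
    (hηM : 128 * M * η ^ 3 ≤ 1)
    (h : X ⊆ X') (h' : X' ⊆ X'') (h'' : X'' ⊆ A)
    (hX0 : X.Nonempty)
    (hcon : (#X' : ℝ) ^ 2 * #(A \ X') ^ 2 ≤ M * #A * addEnergy X' (A \ X'))
    (hd : 16 * M * #A * (addEnergy X (A \ X') : ℝ) ≤ #X ^ 2 * #(A \ X) * #(A \ X'))
    (hd' : 16 * M * #A * (addEnergy X' (A \ X'') : ℝ) ≤ #X' ^ 2 * #(A \ X') * #(A \ X'')) :
    (1 + η) * (#X * #(A \ X'')) ≤ #X'' * (#(A \ X) : ℝ) := by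
  have hXA : X ⊆ A := h.trans (h'.trans h'')
  have hn : (0 : ℝ) < #A := Nat.cast_pos.2 (hX0.mono hXA).card_pos
  have hx : (0 : ℝ) < #X := Nat.cast_pos.2 hX0.card_pos
  have hxx' : (#X : ℝ) ≤ #X' := by exact_mod_cast card_le_card h
  have hxx'' : (#X' : ℝ) ≤ #X'' := by exact_mod_cast card_le_card h'
  have hy' : (#(A \ X'') : ℝ) ≤ #(A \ X') := by
    exact_mod_cast card_le_card (sdiff_subset_sdiff subset_rfl h')
  have hy : (#(A \ X') : ℝ) ≤ #(A \ X) := by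
    exact_mod_cast card_le_card (sdiff_subset_sdiff subset_rfl h)
  have hy0 : (0 : ℝ) ≤ #(A \ X'') := Nat.cast_nonneg _
  have c₁ : (#(A \ X) : ℝ) + #X = #A := by exact_mod_cast card_sdiff_add_card_eq_card hXA
  have c₂ : (#(A \ X'') : ℝ) + #X'' = #A := by exact_mod_cast card_sdiff_add_card_eq_card h''
  have hcube := addEnergy_sdiff_le_cube h h'
  have hE : (addEnergy X' (A \ X') : ℝ) ≤ 2 * addEnergy X (A \ X') +
      4 * addEnergy (X' \ X) (X'' \ X') + 4 * addEnergy X' (A \ X'') := by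
    have e₁ := addEnergy_union_left_le (disjoint_sdiff (s := X) (t := X')) (A \ X')
    have e₂ := addEnergy_union_right_le (Y₁ := X'' \ X') (Y₂ := A \ X'')
      (disjoint_of_subset_left sdiff_subset disjoint_sdiff) (X' \ X)
    rw [union_sdiff_of_subset h] at e₁
    have e₃ : X'' \ X' ∪ A \ X'' = A \ X' := by
      rw [union_comm]
      exact sdiff_union_sdiff_cancel h'' h'
    rw [e₃] at e₂
    have e₄ : (addEnergy (X' \ X) (A \ X'') : ℝ) ≤ addEnergy X' (A \ X'') := by
      exact_mod_cast addEnergy_mono sdiff_subset subset_rfl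
    linarith
  exact ratio_growth_of_energy_bounds hn hM hη hη1 hηM hx hxx' hxx'' hy0 hy' hy c₁ c₂ hcon hE hd
    hcube hd'

/-- Iterated growth of a subset of a set with bounded `energyStar`. -/
theorem exists_iterated_extension {A X : Finset G} {M N η : ℝ} (hX : X ⊆ A) (hX0 : X.Nonempty)
    (hM : 0 < M) (hη : 0 ≤ η) (hη1 : η ≤ 1) (hηM : 128 * M * η ^ 3 ≤ 1)
    (hN : 16 * M * #A / #X + 1 ≤ N) (hA : energyStar A ≤ M) (j : ℕ) :
    ∃ Y U : Finset G, X ⊆ Y ∧ Y ⊆ A ∧ Y ⊆ X + U ∧ (#U : ℝ) ≤ N ^ (2 * j) ∧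
      (1 + η) ^ j * (#X * #(A \ Y)) ≤ #Y * (#(A \ X) : ℝ) := by
  have hx : (0 : ℝ) < #X := Nat.cast_pos.2 hX0.card_pos
  have hN0 : 0 ≤ N := le_trans (by positivity) hN
  induction j with
  | zero => exact ⟨X, {0}, subset_rfl, hX, fun a ha =>
      mem_add.2 ⟨a, ha, 0, mem_singleton_self _, add_zero a⟩, by simp, by simp⟩
  | succ j ih =>
    obtain ⟨Y, U, hXY, hYA, hYU, hU, hg⟩ := ih
    -- The cost of an extension decreases as the set grows, so one `N` serves all `2j` extensions.
    have hmono : ∀ {Z : Finset G}, X ⊆ Z → 16 * M * #A / #Z + 1 ≤ N := fun {Z} hZ => by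
      refine le_trans ?_ hN
      have : (#X : ℝ) ≤ #Z := by exact_mod_cast card_le_card hZ
      gcongr
    obtain ⟨Y', T, hYY', hY'A, hY'T, hT, hd⟩ :=
      exists_decoupled_extension hYA (hX0.mono hXY) hM (hmono hXY)
    obtain ⟨Y'', T', hYY'', hY''A, hY'T', hT', hd'⟩ := exists_decoupled_extension hY'A
      (hX0.mono (hXY.trans hYY')) hM (hmono (hXY.trans hYY'))
    have hgrow := ratio_growth hM hη hη1 hηM hYY' hYY'' hY''A (hX0.mono hXY)
      (card_sq_mul_card_sq_le_of_energyStar_le hA hY'A) hd hd'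
    refine ⟨Y'', U + T + T', hXY.trans (hYY'.trans hYY''), hY''A, ?_, ?_, ?_⟩
    · refine hY'T'.trans ?_
      rw [← add_assoc, ← add_assoc]
      exact add_subset_add_right (hY'T.trans (add_subset_add_right hYU))
    · have h₁ : (#(U + T + T') : ℝ) ≤ #U * #T * #T' := by
        exact_mod_cast card_add_le.trans (Nat.mul_le_mul_right _ card_add_le)
      calc (#(U + T + T') : ℝ) ≤ #U * #T * #T' := h₁
        _ ≤ N ^ (2 * j) * N * N := by gcongr
        _ = _ := by ring
    · have hy : (0 : ℝ) < #Y := Nat.cast_pos.2 (hX0.mono hXY).card_pos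
      have hη0 : (0 : ℝ) ≤ (1 + η) ^ j := by positivity
      have hle : (#(A \ Y) : ℝ) ≥ 0 := Nat.cast_nonneg _
      have h₁ := mul_le_mul_of_nonneg_left hgrow (show 0 ≤ (1 + η) ^ j * (#X : ℝ) by positivity)
      have h₂ := mul_le_mul_of_nonneg_left hg (Nat.cast_nonneg (α := ℝ) #Y'')
      have : (1 + η) ^ (j + 1) * (#X * (#(A \ Y'') : ℝ)) * #Y ≤ #Y'' * #(A \ X) * #Y := by
        rw [pow_succ]; linarith
      exact le_of_mul_le_mul_right this hy

/-- A set with bounded `energyStar` is covered by few translates of the difference set of any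
subset that is nearly everything. -/
theorem exists_cover_of_small_complement {A X : Finset G} {M : ℝ} (hX : X ⊆ A) (hX0 : X.Nonempty)
    (hM : 1 ≤ M) (hA : energyStar A ≤ M) (hY : 16 * M * #(A \ X) ≤ #A) :
    ∃ F : Finset G, (#F : ℝ) ≤ 16 * M + 1 ∧ A ⊆ F + (X - X) := by
  have hn : (0 : ℝ) < #A := Nat.cast_pos.2 (hX0.mono hX).card_pos
  -- A maximal `Z` with differences outside `X - X` covers the rest of `A \ X`. Each difference has
  -- at most one representation in `X - Z`, so `E(X, Z)` is small, and the large energy of the cut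
  -- `Z`, `A \ Z` bounds `|Z|`.
  let S : Finset (Finset G) := (A \ X).powerset.filter fun Z =>
    ∀ z ∈ Z, ∀ w ∈ Z, z - w ∈ X - X → z = w
  obtain ⟨Z, hZS, hmax⟩ := S.exists_max_image card ⟨∅, by simp [S]⟩
  obtain ⟨hZp, hZ⟩ := mem_filter.1 hZS
  have hZY := mem_powerset.1 hZp
  obtain ⟨x₀, hx₀⟩ := hX0
  refine ⟨insert x₀ Z, ?_, ?_⟩
  · have hZA : Z ⊆ A := hZY.trans sdiff_subset
    have hcon := card_sq_mul_card_sq_le_of_energyStar_le hA (sdiff_subset (s := A) (t := Z))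
    rw [Finset.sdiff_sdiff_eq_self hZA] at hcon
    have hc : (#(A \ Z) : ℝ) + #Z = #A := by exact_mod_cast card_sdiff_add_card_eq_card hZA
    have hzy : (#Z : ℝ) ≤ #(A \ X) := by exact_mod_cast card_le_card hZY
    have hXZ : X ∪ (A \ X) \ Z = A \ Z := by
      ext a
      simp only [mem_union, mem_sdiff]
      constructor
      · rintro (h | h)
        · exact ⟨hX h, fun hz => (mem_sdiff.1 (hZY hz)).2 h⟩
        · exact ⟨h.1.1, h.2⟩
      · intro h
        by_cases ha : a ∈ X
        · exact Or.inl ha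
        · exact Or.inr ⟨⟨h.1, ha⟩, h.2⟩
    have hE := addEnergy_union_left_le (X₁ := X) (X₂ := (A \ X) \ Z)
      (disjoint_of_subset_right sdiff_subset disjoint_sdiff) Z
    rw [hXZ] at hE
    have hE₁ : (addEnergy X Z : ℝ) ≤ #A * #Z := by
      have h1 : ∀ d, diffCount X Z d ≤ 1 := fun d => by
        rw [diffCount_eq_card_right]
        norm_cast
        refine card_le_one.2 fun z hz w hw => ?_
        rw [mem_filter] at hz hw
        refine hZ z hz.1 w hw.1 ?_
        rw [show z - w = z + d - (w + d) by abel]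
        exact sub_mem_sub hz.2 hw.2
      have := addEnergy_le_of_diffCount_le h1
      have hxn : (#X : ℝ) ≤ #A := by exact_mod_cast card_le_card hX
      calc (addEnergy X Z : ℝ) ≤ #X * #Z * 1 := this
        _ ≤ _ := by rw [mul_one]; gcongr
    have hE₂ : (addEnergy ((A \ X) \ Z) Z : ℝ) ≤ #(A \ X) * #Z ^ 2 := by
      refine (addEnergy_le_card_mul_sq _ _).trans ?_
      exact mul_le_mul_of_nonneg_right (Nat.cast_le.2 (card_le_card sdiff_subset)) (sq_nonneg _)
    have hins : (#(insert x₀ Z) : ℝ) ≤ #Z + 1 := by exact_mod_cast card_insert_le _ _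
    refine hins.trans ?_
    have hyn : 16 * (#(A \ X) : ℝ) ≤ #A := by
      nlinarith [Nat.cast_nonneg (α := ℝ) #(A \ X)]
    have hhalf : (#A : ℝ) ≤ 2 * #(A \ Z) := by linarith
    have hz0 : (0 : ℝ) ≤ #Z := Nat.cast_nonneg _
    generalize (#Z : ℝ) = z at *
    generalize (#A : ℝ) = n at *
    generalize (#(A \ X) : ℝ) = y at *
    have k₁ : n ^ 2 * z ^ 2 ≤ 4 * (M * n * (2 * (n * z) + 2 * (y * z ^ 2))) := by
      calc n ^ 2 * z ^ 2 ≤ (2 * (#(A \ Z) : ℝ)) ^ 2 * z ^ 2 := by gcongr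
        _ = 4 * (#(A \ Z) ^ 2 * z ^ 2) := by ring
        _ ≤ 4 * (M * n * (2 * (n * z) + 2 * (y * z ^ 2))) := by
            refine mul_le_mul_of_nonneg_left (hcon.trans ?_) (by norm_num)
            gcongr
            linarith
    have k₂ : n ^ 2 * z ^ 2 ≤ 8 * M * n ^ 2 * z + n ^ 2 * z ^ 2 / 2 := by
      have := mul_le_mul_of_nonneg_right hY (show 0 ≤ n * z ^ 2 by positivity)
      nlinarith
    rcases hz0.eq_or_lt with h0 | h0
    · rw [← h0]; linarith
    have k₃ : z * (n ^ 2 * z) ≤ 16 * M * (n ^ 2 * z) := by linarith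
    have := le_of_mul_le_mul_right k₃ (by positivity)
    linarith
  · intro a ha
    by_cases haX : a ∈ X
    · exact mem_add.2 ⟨x₀, mem_insert_self _ _, a - x₀, sub_mem_sub haX hx₀, by abel⟩
    by_contra hnot
    have hnot' : ∀ z ∈ Z, a - z ∉ X - X := fun z hz h =>
      hnot (mem_add.2 ⟨z, mem_insert_of_mem hz, a - z, h, by abel⟩)
    have hsymm : ∀ g, g ∈ X - X → -g ∈ X - X := fun g hg => by
      obtain ⟨p, hp, q, hq, rfl⟩ := mem_sub.1 hg
      rw [neg_sub]
      exact sub_mem_sub hq hp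
    have haZ : a ∉ Z := fun h => hnot' a h (by
      rw [sub_self, ← sub_self x₀]; exact sub_mem_sub hx₀ hx₀)
    have hmem : insert a Z ∈ S := by
      refine mem_filter.2 ⟨mem_powerset.2 (insert_subset (mem_sdiff.2 ⟨ha, haX⟩) hZY), ?_⟩
      intro z hz w hw hzw
      rcases mem_insert.1 hz with rfl | hz' <;> rcases mem_insert.1 hw with rfl | hw'
      · rfl
      · exact absurd hzw (hnot' w hw')
      · exact absurd (by simpa using hsymm _ hzw) (hnot' z hz')
      · exact hZ z hz' w hw' hzw
    have := hmax _ hmem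
    rw [card_insert_of_notMem haZ] at this
    omega

end Growth

/-! ### From bounded `E_*` to small doubling -/

section Doubling

variable {G : Type*} [AddCommGroup G] [DecidableEq G]

/-- Cut `A` into two nearly equal halves; `36 = 3² · 2²` allows for rounding down. A singleton has
no proper cut and is treated directly. -/
theorem card_cube_div_le_addEnergy {A : Finset G} {M : ℝ} (hM : 1 ≤ M) (hA0 : A.Nonempty)
    (hA : energyStar A ≤ M) : (#A : ℝ) ^ 3 / (36 * M) ≤ addEnergy A A := by
  rw [div_le_iff₀ (by positivity)]
  rcases Nat.lt_or_ge (#A) 2 with h | h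
  · have h1 : #A = 1 := by have := hA0.card_pos; omega
    have h2 : (1 : ℝ) ≤ addEnergy A A := by exact_mod_cast addEnergy_pos hA0 hA0
    rw [h1]
    norm_num
    nlinarith
  obtain ⟨X, hX, hXc⟩ := exists_subset_card_eq (show #A / 2 ≤ #A from Nat.div_le_self _ _)
  have hc := card_sdiff_add_card_eq_card hX
  have hx : (#A : ℝ) ≤ 3 * #X := by
    have : #A ≤ 3 * #X := by omega
    exact_mod_cast this
  have hy : (#A : ℝ) ≤ 2 * #(A \ X) := by
    have : #A ≤ 2 * #(A \ X) := by omega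
    exact_mod_cast this
  have hn : (0 : ℝ) < #A := Nat.cast_pos.2 hA0.card_pos
  have hcon := card_sq_mul_card_sq_le_of_energyStar_le hA hX
  have hE : (addEnergy X (A \ X) : ℝ) ≤ addEnergy A A := by
    exact_mod_cast addEnergy_mono hX sdiff_subset
  have : (#A : ℝ) ^ 3 * #A ≤ addEnergy A A * (36 * M) * #A := by
    calc (#A : ℝ) ^ 3 * #A = (#A : ℝ) ^ 2 * (#A : ℝ) ^ 2 := by ring
      _ ≤ (3 * (#X : ℝ)) ^ 2 * (2 * (#(A \ X) : ℝ)) ^ 2 := by gcongr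
      _ = 36 * ((#X : ℝ) ^ 2 * (#(A \ X) : ℝ) ^ 2) := by ring
      _ ≤ 36 * (M * #A * addEnergy A A) := by
          refine mul_le_mul_of_nonneg_left (hcon.trans ?_) (by norm_num)
          gcongr
      _ = _ := by ring
  exact le_of_mul_le_mul_right this hn

theorem card_two_nsmul_sub_two_nsmul_le {X : Finset G} (hX : X.Nonempty) {κ : ℝ}
    (h : (#(X - X) : ℝ) ≤ κ * #X) : (#(2 • X - 2 • X) : ℝ) ≤ κ ^ 4 * #X := by
  have hx : (0 : ℝ) < #X := Nat.cast_pos.2 hX.card_pos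
  have hp : (#(2 • X - 2 • X) : ℝ) ≤ ((#(X - X) : ℝ) / #X) ^ (2 + 2) * #X := by
    have h := (NNRat.cast_le (K := ℝ)).2 (pluennecke_ruzsa_inequality_nsmul_sub_nsmul_sub hX X 2 2)
    push_cast at h
    exact_mod_cast h
  refine hp.trans ?_
  have : (#(X - X) : ℝ) / #X ≤ κ := by rwa [div_le_iff₀ hx]
  gcongr

/-- The doubling of a set covered by sums and differences of other sets. -/
theorem card_add_self_le_of_cover {A Y X U F : Finset G} (hA : A ⊆ F + (Y - Y))
    (hY : Y ⊆ X + U) : #(A + A) ≤ #F ^ 2 * #U ^ 4 * #(2 • X - 2 • X) := by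
  have h₁ : A ⊆ F + (X + U - (X + U)) :=
    hA.trans (add_subset_add_left (sub_subset_sub hY hY))
  have h₂ : F + (X + U - (X + U)) + (F + (X + U - (X + U))) =
      (F + F) + ((U - U) + (U - U)) + (2 • X - 2 • X) := by
    simp only [sub_eq_add_neg, neg_add, two_nsmul]
    ac_rfl
  calc #(A + A) ≤ #((F + F) + ((U - U) + (U - U)) + (2 • X - 2 • X)) :=
        card_le_card (h₂ ▸ add_subset_add h₁ h₁)
    _ ≤ #F * #F * ((#U * #U) * (#U * #U)) * #(2 • X - 2 • X) := by
        refine card_add_le.trans (Nat.mul_le_mul_right _ (card_add_le.trans ?_))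
        refine Nat.mul_le_mul card_add_le (card_add_le.trans (Nat.mul_le_mul ?_ ?_)) <;>
        exact card_sub_le
    _ = _ := by ring

theorem exp_half_le_one_add {η : ℝ} (h0 : 0 ≤ η) (h1 : η ≤ 1) : Real.exp (η / 2) ≤ 1 + η := by
  have h := Real.add_one_le_exp (-(η / 2))
  have hpos := Real.exp_pos (η / 2)
  have he : Real.exp (-(η / 2)) * Real.exp (η / 2) = 1 := by
    rw [← Real.exp_add]; simp
  have h2 : (-(η / 2) + 1) * Real.exp (η / 2) ≤ 1 := by
    rw [← he]; exact mul_le_mul_of_nonneg_right (by linarith) hpos.le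
  have h3 : 1 ≤ (-(η / 2) + 1) * (1 + η) := by nlinarith
  have h4 : (-(η / 2) + 1) * Real.exp (η / 2) ≤ (-(η / 2) + 1) * (1 + η) := h2.trans h3
  exact le_of_mul_le_mul_left h4 (by linarith)

/-- A set with `energyStar A ≤ M` has doubling at most `exp (O (M ^ (1 / 3) * log M ^ 2))`. -/
theorem doubling_le_of_energyStar_le {A : Finset G} (hA0 : A.Nonempty) {M : ℝ} (hM : 1024 ≤ M)
    (hA : energyStar A ≤ M) :
    doubling A ≤ Real.exp (1604 * (M ^ (1 / 3 : ℝ) * Real.log M ^ 2)) := by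
  have hM0 : 0 < M := by linarith
  have hM2 : 1024 * M ≤ M ^ 2 := by nlinarith
  have hM4 : 1024 ^ 4 ≤ M ^ 4 := by gcongr
  set n : ℝ := (#A : ℝ) with hn
  have hn0 : 0 < n := Nat.cast_pos.2 hA0.card_pos
  obtain ⟨X, hXA, hXn, hXX⟩ := exists_subset_small_difference hA0 (κ := 36 * M) (by positivity)
    (card_cube_div_le_addEnergy (by linarith) hA0 hA)
  have hXn' : n ≤ 144 * M * #X := by
    rw [div_le_iff₀ (by positivity)] at hXn
    linarith
  have hx : (0 : ℝ) < #X := by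
    by_contra! h
    have : 144 * M * (#X : ℝ) ≤ 0 := mul_nonpos_of_nonneg_of_nonpos (by positivity) h
    linarith
  have hX0 : X.Nonempty := card_pos.1 (by exact_mod_cast hx)
  have hXX' : (#(X - X) : ℝ) ≤ M ^ 8 * #X := by
    calc (#(X - X) : ℝ) ≤ 1024 * (36 * M) ^ 3 * n := hXX
      _ ≤ 1024 * (36 * M) ^ 3 * (144 * M * #X) := by gcongr
      _ = 1024 * 36 ^ 3 * 144 * (M ^ 4 * #X) := by ring
      _ ≤ 1024 ^ 4 * (M ^ 4 * #X) := by gcongr; norm_num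
      _ ≤ M ^ 4 * (M ^ 4 * #X) := by gcongr
      _ = _ := by ring
  have hN : 16 * M * n / #X + 1 ≤ M ^ 4 := by
    have : 16 * M * n / #X ≤ 16 * M * (144 * M) := by
      rw [div_le_iff₀ hx, mul_assoc _ (144 * M)]
      gcongr
    nlinarith
  set c : ℝ := M ^ (1 / 3 : ℝ) with hc
  have hc3 : c ^ 3 = M := by
    rw [hc, ← Real.rpow_natCast, ← Real.rpow_mul hM0.le]; norm_num
  have hc1 : 1 ≤ c := Real.one_le_rpow (by linarith) (by norm_num)
  set L : ℝ := Real.log M with hL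
  have hL1 : 1 ≤ L := by
    rw [hL, Real.le_log_iff_exp_le hM0]
    linarith [Real.exp_one_lt_d9]
  set η : ℝ := 1 / (6 * c) with hη
  have hη0 : 0 ≤ η := by positivity
  have hη1 : η ≤ 1 := by
    rw [hη, div_le_one (by positivity)]; linarith
  have hηM : 128 * M * η ^ 3 ≤ 1 := by
    have : 128 * M * η ^ 3 = 128 / 216 := by
      rw [hη, ← hc3]; field_simp; norm_num
    rw [this]; norm_num
  -- Since `48 c L · η / 2 = 4L`, the ratio grows by at least `M⁴`, which beats `|A| / |X| ≤ 144M`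
  -- and the factor `16M` needed for covering.
  set j : ℕ := ⌈48 * (c * L)⌉₊ with hj
  obtain ⟨Y, U, hXY, hYA, hYU, hU, hg⟩ :=
    exists_iterated_extension hXA hX0 hM0 hη0 hη1 hηM hN hA j
  have hpow : M ^ 4 ≤ (1 + η) ^ j := by
    calc M ^ 4 = Real.exp (4 * L) := by
          rw [hL, mul_comm, Real.exp_mul, Real.exp_log hM0]; norm_cast
      _ ≤ Real.exp (j * (η / 2)) := by
          refine Real.exp_le_exp.2 ?_
          calc 4 * L = 48 * (c * L) * (η / 2) := by rw [hη]; field_simp; norm_num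
            _ ≤ j * (η / 2) := by gcongr; exact Nat.le_ceil _
      _ = Real.exp (η / 2) ^ j := by rw [Real.exp_nat_mul]
      _ ≤ _ := by gcongr; exact exp_half_le_one_add hη0 hη1
  have hsmall : 16 * M * (#(A \ Y) : ℝ) ≤ n := by
    have hYn : (#Y : ℝ) ≤ n := Nat.cast_le.2 (card_le_card hYA)
    have hXn2 : (#(A \ X) : ℝ) ≤ n := Nat.cast_le.2 (card_le_card sdiff_subset)
    have h1 : M ^ 4 * (#X * (#(A \ Y) : ℝ)) ≤ n * n :=
      calc M ^ 4 * (#X * (#(A \ Y) : ℝ)) ≤ (1 + η) ^ j * (#X * (#(A \ Y) : ℝ)) := by gcongr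
        _ ≤ #Y * #(A \ X) := hg
        _ ≤ n * n := by gcongr
    have h2 : 16 * M * (#(A \ Y) : ℝ) * n ≤ n * n := by
      refine le_trans ?_ h1
      have hc : 2304 * M ^ 2 ≤ M ^ 4 := by nlinarith
      calc 16 * M * (#(A \ Y) : ℝ) * n ≤ 16 * M * #(A \ Y) * (144 * M * #X) := by gcongr
        _ = 2304 * M ^ 2 * (#X * (#(A \ Y) : ℝ)) := by ring
        _ ≤ _ := by gcongr
    exact le_of_mul_le_mul_right h2 hn0
  obtain ⟨F, hF, hcov⟩ :=
    exists_cover_of_small_complement hYA (hX0.mono hXY) (by linarith) hA hsmall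
  have hF' : (#F : ℝ) ≤ M ^ 2 := by linarith
  have hAA : (#(A + A) : ℝ) ≤ #F ^ 2 * #U ^ 4 * #(2 • X - 2 • X) := by
    exact_mod_cast card_add_self_le_of_cover hcov hYU
  -- Exponents: `4` from `F`, `32j` from `U`, and `32` from `2X - 2X`.
  have hbound : (#(A + A) : ℝ) ≤ M ^ (36 + 32 * j) * n := by
    have hxn : (#X : ℝ) ≤ n := Nat.cast_le.2 (card_le_card hXA)
    calc (#(A + A) : ℝ) ≤ #F ^ 2 * #U ^ 4 * #(2 • X - 2 • X) := hAA
      _ ≤ (M ^ 2) ^ 2 * ((M ^ 4) ^ (2 * j)) ^ 4 * ((M ^ 8) ^ 4 * #X) := by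
          have := card_two_nsmul_sub_two_nsmul_le hX0 hXX'
          gcongr
      _ ≤ (M ^ 2) ^ 2 * ((M ^ 4) ^ (2 * j)) ^ 4 * ((M ^ 8) ^ 4 * n) := by gcongr
      _ = M ^ (36 + 32 * j) * n := by
          simp only [← pow_mul]
          rw [← mul_assoc, ← pow_add, ← pow_add]
          congr 2
          ring
  have hcL : 1 ≤ c * L := one_le_mul_of_one_le_of_one_le hc1 hL1
  have hjle : (j : ℝ) ≤ 49 * (c * L) := by
    have h1 : (j : ℝ) < 48 * (c * L) + 1 := Nat.ceil_lt_add_one (by positivity)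
    linarith
  clear_value j c L n
  calc doubling A ≤ M ^ (36 + 32 * j) := by
        unfold doubling
        rwa [← hn, div_le_iff₀ hn0]
    _ = Real.exp ((36 + 32 * j : ℕ) * L) := by
        rw [hL, Real.exp_nat_mul, Real.exp_log hM0]
    _ ≤ _ := by
        refine Real.exp_le_exp.2 ?_
        push_cast
        calc (36 + 32 * (j : ℝ)) * L ≤ (36 * (c * L) + 32 * (49 * (c * L))) * L := by
              gcongr; linarith
          _ = _ := by ring

end Doubling

/-! ### Assembling the theorem -/

theorem theorem5p1 :
    ∃ C : ℝ, 0 < C ∧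
      ∀ {G : Type*} [AddCommGroup G] [DecidableEq G] (A : Finset G) (K ε ω : ℝ),
        0 < K → (Finset.addEnergy A A : ℝ) = (#A : ℝ) ^ 3 / K →
        0 < ε → ε ≤ 1 / 4 → 0 < ω → ω ≤ 1 / 4 →
        ∃ (k : ℕ) (P : Fin k → Finset G) (Ω : Finset G),
          (∀ i j, i ≠ j → Disjoint (P i) (P j)) ∧
          (∀ j, Disjoint (P j) Ω) ∧
          Finset.univ.biUnion P ∪ Ω = A ∧
          (∀ j, √(ω / (2 * K)) * (#A : ℝ) ≤ (#(P j) : ℝ)) ∧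
          (∀ j, energyStar (P j) ≤ 4 * K * ((ω * ε) ^ 2)⁻¹) ∧
          (∀ j, doubling (P j) ≤
            Real.exp (C * (K ^ (1 / 3 : ℝ) * (ω * ε) ^ (-(2 / 3) : ℝ) *
              Real.log (K * ω⁻¹ * ε⁻¹) ^ 2))) ∧
          (∀ i j, i ≠ j → (Finset.addEnergy (P i) (P j) : ℝ) ≤
            ε * ((#(P i) : ℝ) ^ 2 * (#(P j) : ℝ) ^ 2 / (#A : ℝ))) ∧
          (Finset.addEnergy Ω A : ℝ) ≤ ω * (Finset.addEnergy A A : ℝ) := by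
  -- `28872 = 1604 · 2 · 3²`: factor `2` from the cube root of `M = 4K(ωε)⁻²`, and `3²` from `log M
  -- ≤ 3 log(K/(ωε))`.
  refine ⟨28872, by norm_num, ?_⟩
  intro G _ _ A K ε ω hK hE hε hε' hω hω'
  rcases A.eq_empty_or_nonempty with rfl | hA
  · exact ⟨0, fun _ => ∅, ∅, by simp⟩
  obtain ⟨Q, Ω, hdis, hΩ, hun, hcard, hstar, hij, hEΩ⟩ :=
    exists_energy_decomposition hA hK hE hε hε' hω hω'
  have hn : (0 : ℝ) < #A := Nat.cast_pos.2 hA.card_pos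
  have hK1 : 1 ≤ K := by
    have h := addEnergy_self_le A
    rw [hE, div_le_iff₀ hK] at h
    have h3 : (0 : ℝ) < (#A : ℝ) ^ 3 := by positivity
    exact le_of_mul_le_mul_left (by linarith) h3
  set t : ℝ := ω * ε with ht
  have ht0 : 0 < t := mul_pos hω hε
  have ht1 : t ≤ 1 / 16 := by
    calc t ≤ 1 / 4 * (1 / 4) := mul_le_mul hω' hε' hε.le (by norm_num)
      _ = 1 / 16 := by norm_num
  have hti : 16 ≤ t⁻¹ := by
    rw [le_inv_comm₀ (by norm_num) ht0]; linarith
  set M : ℝ := 4 * K * (t ^ 2)⁻¹ with hM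
  have hMt : M = 4 * K * (t⁻¹ ^ 2) := by rw [hM, inv_pow]
  have hM1 : 1024 ≤ M := by
    rw [hMt]
    calc (1024 : ℝ) = 4 * 1 * 16 ^ 2 := by norm_num
      _ ≤ _ := by gcongr
  have hroot : M ^ (1 / 3 : ℝ) ≤ 2 * (K ^ (1 / 3 : ℝ) * t ^ (-(2 / 3) : ℝ)) := by
    have h4 : (4 : ℝ) ^ (1 / 3 : ℝ) ≤ 2 := by
      calc (4 : ℝ) ^ (1 / 3 : ℝ) ≤ (2 ^ (3 : ℝ)) ^ (1 / 3 : ℝ) := by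
            gcongr; norm_num
        _ = 2 := by rw [← Real.rpow_mul (by norm_num)]; norm_num
    have h2 : ((t ^ 2)⁻¹) ^ (1 / 3 : ℝ) = t ^ (-(2 / 3) : ℝ) := by
      rw [← Real.rpow_natCast, ← Real.rpow_neg ht0.le, ← Real.rpow_mul ht0.le]
      norm_num
    rw [hM, Real.mul_rpow (by positivity) (by positivity), Real.mul_rpow (by norm_num) hK.le, h2,
      mul_assoc]
    gcongr
  have hlog : Real.log M ≤ 3 * Real.log (K * ω⁻¹ * ε⁻¹) := by
    have e : K * ω⁻¹ * ε⁻¹ = K * t⁻¹ := by rw [ht, mul_inv, mul_assoc]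
    rw [e, show (3 : ℝ) = ((3 : ℕ) : ℝ) by norm_num, ← Real.log_pow]
    refine Real.log_le_log (by linarith) ?_
    calc M = 4 * K * (t⁻¹ ^ 2) := hMt
      -- The constant `4` is absorbed by `t⁻¹ ≥ 16`, and `K ≤ K³` because `K ≥ 1`.
      _ ≤ t⁻¹ * K ^ 3 * (t⁻¹ ^ 2) := by
          gcongr
          · linarith
          · exact le_self_pow₀ hK1 three_ne_zero
      _ = _ := by ring
  have hlog0 : 0 ≤ Real.log M := Real.log_nonneg (by linarith)
  have hP : ∀ i : Fin #Q, (Q.equivFin.symm i : Finset G) ∈ Q := fun i => (Q.equivFin.symm i).2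
  have hne : ∀ i j : Fin #Q, i ≠ j →
      (Q.equivFin.symm i : Finset G) ≠ (Q.equivFin.symm j : Finset G) := fun i j h h' =>
    h (Q.equivFin.symm.injective (Subtype.ext h'))
  refine ⟨#Q, fun i => Q.equivFin.symm i, Ω,
    fun i j h => hdis _ (hP i) _ (hP j) (hne i j h), fun j => hΩ _ (hP j), ?_,
    fun j => hcard _ (hP j), fun j => hstar _ (hP j), ?_,
    fun i j h => hij _ (hP i) _ (hP j) (hne i j h), hEΩ⟩
  · rw [← hun]
    congr 1
    ext a
    simp only [mem_biUnion, mem_univ, true_and, id]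
    constructor
    · rintro ⟨i, hi⟩
      exact ⟨_, hP i, hi⟩
    · rintro ⟨X, hX, ha⟩
      exact ⟨Q.equivFin ⟨X, hX⟩, by simpa using ha⟩
  · intro j
    have hpos : (0 : ℝ) < #(Q.equivFin.symm j : Finset G) :=
      lt_of_lt_of_le (by positivity) (hcard _ (hP j))
    refine (doubling_le_of_energyStar_le (card_pos.1 (by exact_mod_cast hpos)) hM1
      (hstar _ (hP j))).trans (Real.exp_le_exp.2 ?_)
    calc 1604 * (M ^ (1 / 3 : ℝ) * Real.log M ^ 2)
        ≤ 1604 * (2 * (K ^ (1 / 3 : ℝ) * t ^ (-(2 / 3) : ℝ)) *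
          (3 * Real.log (K * ω⁻¹ * ε⁻¹)) ^ 2) := by gcongr
      _ = _ := by ring
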